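/- **Corollary (Sparse Covariance Estimation).** Notation. For $A\in\mathbb R^{p\times p}$ let $\|A\|_{\infty,\mathrm{off}}$ and $\|A\|_{1,\mathrm{off}}$ be the maximum and the sum of the absolute values of the off-diagonal entries, and let $A_d$ be the diagonal of $A$. For a covariance matrix $\Sigma^*$ let $d_\Sigma:=\max_j|\{i:\Sigma^*_{ij}\neq0\}|$ (the diagonal entry is counted). Given a symmetric matrix $\widehat\Sigma^n$ and $\gamma,\lambda\ge 0$, consider the primal program $$\widehat J_M:=\arg\min_{J\succ0,\ \|J\|_{\infty,\mathrm{off}}\le\lambda}\ \langle\widehat\Sigma^n,J\rangle-\log\det J+\gamma\|J\|_{1,\mathrm{off}}$$ and the dual program $$(\widehat\Sigma_M,\widehat\Sigma_R):=\arg\max_{\Sigma_M,\Sigma_R}\ \log\det\Sigma_M-\lambda\|\Sigma_R\|_{1,\mathrm{off}}$$ subject to $\|\widehat\Sigma^n-\Sigma_M+\Sigma_R\|_{\infty,\mathrm{off}}\le\gamma$, $(\Sigma_M)_d=(\widehat\Sigma^n)_d$, $(\Sigma_R)_d=0$, $\Sigma_M\succ0$, $\Sigma_M-\Sigma_R\succ0$.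 The covariance estimate $\widehat\Sigma$ has the off-diagonal entries of $-\widehat\Sigma_R$ and the diagonal of $\widehat\Sigma_M$. Statement. Let $K>0$ and $\tau>2$. There is a constant $C_{1,0}>0$, depending only on $K,\tau$, such that for all $C_1\ge C_{1,0}$ and $C_2>0$ there are constants $C_6,C_7,c_{\min},c_0,C>0$, depending only on $K,\tau,C_1,C_2$, for which the following holds. Let $p,n\ge1$ and let $\Sigma^*\in\mathbb R^{p\times p}$ be a positive definite covariance matrix with $\max_i\Sigma^*_{ii}\le K$ such that * (eigenvalue control) $\lambda_{\min}(\Sigma^*)\ \ge\ C_6\,d_\Sigma\sqrt{\dfrac{\log(4p^\tau)}{n}}+C_7\,d_\Sigma^2\,\dfrac{\log(4p^\tau)}{n}$; * $|\Sigma^*_{ij}|\ge c_{\min}\sqrt{\log p/n}$ for all $i\ne j$ with $\Sigma^*_{ij}\ne0$; * $n\ge c_0\,d_\Sigma^2\log p$. Let $x_{(1)},\dots,x_{(n)}$ be i.i.d. samples from $\mathcal N(0,\Sigma^*)$, let $\widehat\Sigma^n=\frac1n\sum_{k}x_{(k)}x_{(k)}^T$, and set $\gamma=C_1\sqrt{\log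 p/n}$ and $\lambda=C_2\sqrt{\log p/n}$. Then with probability greater than $1-1/p^{\tau-2}$ there are optimal solutions $\widehat J_M$ of the primal program and $(\widehat\Sigma_M,\widehat\Sigma_R)$ of the dual program with $\widehat\Sigma_M=\widehat J_M^{-1}$, the dual solution $(\widehat\Sigma_M,\widehat\Sigma_R)$ is unique, and (a) $\|\widehat\Sigma-\Sigma^*\|_{\infty,\mathrm{off}}\le C\sqrt{\log p/n}$; (b) the off-diagonal support of $\widehat\Sigma$ equals that of $\Sigma^*$, and $\operatorname{sign}(\widehat\Sigma_{ij})=\operatorname{sign}(\Sigma^*_{ij})$ for all $i\ne j$. -/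

import Mathlib

open MeasureTheory ProbabilityTheory

namespace SparseCov

noncomputable section

/-- The elementwise norm `‖A‖_{∞,off}`: largest absolute value of an off-diagonal entry
(it is `0` if there are no off-diagonal entries). -/
def offLinf {p : ℕ} (A : Matrix (Fin p) (Fin p) ℝ) : ℝ :=
  ⨆ e : Fin p × Fin p, if e.1 = e.2 then 0 else |A e.1 e.2|

/-- The elementwise norm `‖A‖_{1,off}`: sum of the absolute values of the off-diagonal entries. -/
def offL1 {p : ℕ} (A : Matrix (Fin p) (Fin p) ℝ) : ℝ :=
  ∑ i, ∑ j, if i = j then 0 else |A i j|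

/-- `‖A‖_{∞,off} ≤ b` says what it should. -/
theorem offLinf_le_iff {p : ℕ} (A : Matrix (Fin p) (Fin p) ℝ) {b : ℝ} (hb : 0 ≤ b) :
    offLinf A ≤ b ↔ ∀ i j, i ≠ j → |A i j| ≤ b := by
  unfold offLinf
  constructor
  · intro h i j hij
    have h1 := (le_ciSup (f := fun e : Fin p × Fin p =>
      if e.1 = e.2 then (0 : ℝ) else |A e.1 e.2|) (Set.finite_range _).bddAbove (i, j)).trans h
    simpa [hij] using h1
  · intro h
    refine Real.iSup_le (fun e => ?_) hb
    split_ifs with he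
    · exact hb
    · exact h _ _ he

/-- The off-diagonal support. -/
def offSupport {p : ℕ} (A : Matrix (Fin p) (Fin p) ℝ) : Set (Fin p × Fin p) :=
  {e | e.1 ≠ e.2 ∧ A e.1 e.2 ≠ 0}

/-- Maximum node degree `d_Σ = max_j |{i : Σ_ij ≠ 0}|` (the diagonal is counted). -/
def maxDegree {p : ℕ} (A : Matrix (Fin p) (Fin p) ℝ) : ℕ :=
  Finset.univ.sup fun j => {i | A i j ≠ 0}.ncard

/-- The smallest eigenvalue of a real symmetric matrix. -/
def minEigenvalue {p : ℕ} {A : Matrix (Fin p) (Fin p) ℝ} (hA : A.IsHermitian) : ℝ :=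
  ⨅ i, hA.eigenvalues i

/-- The rate `√(log p / n)`. -/
def rate (p n : ℕ) : ℝ := Real.sqrt (Real.log p / n)

/-- Eigenvalue control:
`λ_min(A) ≥ C₆ d √(log(4 p^τ) / n) + C₇ d² log(4 p^τ) / n` with `d` the maximum node degree. -/
def EigenvalueControl {p : ℕ} (C₆ C₇ τ : ℝ) (n : ℕ) {A : Matrix (Fin p) (Fin p) ℝ}
    (hA : A.IsHermitian) : Prop :=
  C₆ * (maxDegree A : ℝ) * Real.sqrt (Real.log (4 * (p : ℝ) ^ τ) / n)
    + C₇ * (maxDegree A : ℝ) ^ 2 * (Real.log (4 * (p : ℝ) ^ τ) / n) ≤ minEigenvalue hA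

/-- The sample covariance matrix `(1/n) ∑ₖ xₖ xₖᵀ` (zero-mean model). -/
def sampleCov {p n : ℕ} (x : Fin n → EuclideanSpace ℝ (Fin p)) : Matrix (Fin p) (Fin p) ℝ :=
  (n : ℝ)⁻¹ • ∑ k, Matrix.vecMulVec (x k).ofLp (x k).ofLp

/-- Feasible points `J_M` of the primal program. -/
structure PrimalFeasible {p : ℕ} (lam : ℝ) (J : Matrix (Fin p) (Fin p) ℝ) : Prop where
  posDef : J.PosDef
  bounded : offLinf J ≤ lam

/-- Objective of the primal program: `⟨S, J⟩ - log det J + γ ‖J‖_{1,off}`. -/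
def primalObjective {p : ℕ} (S : Matrix (Fin p) (Fin p) ℝ) (γ : ℝ)
    (J : Matrix (Fin p) (Fin p) ℝ) : ℝ :=
  (S.transpose * J).trace - Real.log J.det + γ * offL1 J

/-- `J` is an optimal solution (minimiser) of the primal program. -/
def PrimalOptimal {p : ℕ} (S : Matrix (Fin p) (Fin p) ℝ) (γ lam : ℝ)
    (J : Matrix (Fin p) (Fin p) ℝ) : Prop :=
  PrimalFeasible lam J ∧
    ∀ J', PrimalFeasible lam J' → primalObjective S γ J ≤ primalObjective S γ J'

/-- Feasible points `(Σ_M, Σ_R)` of the dual program. -/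
structure DualFeasible {p : ℕ} (S : Matrix (Fin p) (Fin p) ℝ) (γ : ℝ)
    (M R : Matrix (Fin p) (Fin p) ℝ) : Prop where
  fit : offLinf (S - M + R) ≤ γ
  diag_M : ∀ i, M i i = S i i
  diag_R : ∀ i, R i i = 0
  posDef_M : M.PosDef
  posDef_sub : (M - R).PosDef

/-- Objective of the dual program: `log det Σ_M - λ ‖Σ_R‖_{1,off}`. -/
def dualObjective {p : ℕ} (lam : ℝ) (M R : Matrix (Fin p) (Fin p) ℝ) : ℝ :=
  Real.log M.det - lam * offL1 R

/-- `(M, R)` is an optimal solution (maximiser) of the dual program. -/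
def DualOptimal {p : ℕ} (S : Matrix (Fin p) (Fin p) ℝ) (γ lam : ℝ)
    (M R : Matrix (Fin p) (Fin p) ℝ) : Prop :=
  DualFeasible S γ M R ∧
    ∀ M' R', DualFeasible S γ M' R' → dualObjective lam M' R' ≤ dualObjective lam M R

/-- The covariance estimate: `-Σ_R` off the diagonal, the diagonal of `Σ_M` on it. -/
def covEstimate {p : ℕ} (M R : Matrix (Fin p) (Fin p) ℝ) : Matrix (Fin p) (Fin p) ℝ :=
  Matrix.of fun i j => if i = j then M i i else -R i j

/-- Given the sample covariance matrix `S`: the programs have an optimal primal-dual pair with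
`Σ_M = J_M⁻¹`, the optimal `(Σ_M, Σ_R)` is unique, and the resulting covariance estimate is within
`err` of `A` off the diagonal and has the off-diagonal support and signs of `A`. -/
def Recovers {p : ℕ} (S : Matrix (Fin p) (Fin p) ℝ) (γ lam err : ℝ)
    (A : Matrix (Fin p) (Fin p) ℝ) : Prop :=
  ∃ J M R : Matrix (Fin p) (Fin p) ℝ,
    PrimalOptimal S γ lam J ∧ DualOptimal S γ lam M R ∧ M = J⁻¹ ∧
    (∀ M' R', DualOptimal S γ lam M' R' → M' = M ∧ R' = R) ∧
    offLinf (covEstimate M R - A) ≤ err ∧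
    offSupport (covEstimate M R) = offSupport A ∧
    ∀ i j, i ≠ j → SignType.sign (covEstimate M R i j) = SignType.sign (A i j)

end

end SparseCov

/-!
The regularisation levels `γ = C₁ √(log p / n)` and `lam = C₂ √(log p / n)` are so small that the
primal solution is known off the diagonal in advance: `J i j = -lam * sign (Σ* i j)` on the support
of `Σ*`, and `0` elsewhere (`saturatedPattern`). Only the diagonal of `J` has to be found, and it is
determined by the condition that `J⁻¹` have the diagonal of the sample covariance matrix `S`;
`exists_diagonal_inv_diag_eq` solves this by minimising over a box of diagonals.

Write `J = V⁻¹ + F` with `V` diagonal and `F` off-diagonal. Then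
`J⁻¹ = V - V F V + V (F J⁻¹ F) V`. Off the support of `Σ*` the first-order term vanishes and the
rest is of size `d lam²`, which the sample size condition makes small compared with `γ`. With
`R = J⁻¹ - S + γ sign Σ*` on the support and `R = 0` off it (`boxMultiplier`), the pair `(J, R)`
satisfies the optimality conditions `IsKKTPair`: off the support because `|J⁻¹ - S| ≤ γ`, on the
support because the lower bound on `|Σ* i j|` makes `-R i j` have the sign of `Σ* i j`. The
eigenvalue condition is what makes `J⁻¹ - R` positive definite: it differs from `Σ*` by a matrix
whose row sums are at most `d (δ + γ)` plus a multiple of `(d lam)²`, where `δ` is the entrywise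
error of `S`. All this is `recovers_of_entrywise_close`.

The optimality conditions suffice for both programs because `log det` lies below its tangents, and
since it touches each of them only once they also give uniqueness of the dual solution
(`IsKKTPair.primalOptimal`, `IsKKTPair.dualOptimal`, `IsKKTPair.dual_unique`).

The entrywise error of `S` is controlled by a Bernstein bound for products of Gaussian coordinates
and a union bound over the entries (`exists_event_sampleCov_close`).
-/

namespace SparseCov

/-! ### Positive definiteness and the tangent inequality for `log det` -/

section LinearAlgebra

-- the order and the C⋆-norm give the factorisation `B⁻¹ = Cᴴ * C` used below
open Matrix MatrixOrder Norms.L2Operator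

variable {ι : Type*} [Fintype ι] [DecidableEq ι]

/-- Strict diagonal dominance, through Gershgorin's theorem. -/
theorem posDef_of_sum_row_lt_diag {A : Matrix ι ι ℝ} (hA : A.IsHermitian)
    (h : ∀ i, ∑ j ∈ Finset.univ.erase i, |A i j| < A i i) : A.PosDef := by
  rw [hA.posDef_iff_eigenvalues_pos]
  intro i
  have hev : Module.End.HasEigenvalue (Matrix.toLin' A) (hA.eigenvalues i) := by
    rw [Module.End.hasEigenvalue_iff_mem_spectrum, Matrix.spectrum_toLin']
    exact hA.eigenvalues_mem_spectrum_real i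
  obtain ⟨k, hk⟩ := eigenvalue_mem_ball hev
  rw [Metric.mem_closedBall, Real.dist_eq] at hk
  have h1 := h k
  simp only [Real.norm_eq_abs] at hk
  have h2 := (abs_le.1 hk).1
  linarith

theorem posSemidef_sub_minEigenvalue {p : ℕ} {A : Matrix (Fin p) (Fin p) ℝ}
    (hA : A.IsHermitian) : (A - minEigenvalue hA • (1 : Matrix (Fin p) (Fin p) ℝ)).PosSemidef := by
  have hB : (A - minEigenvalue hA • (1 : Matrix (Fin p) (Fin p) ℝ)).IsHermitian :=
    hA.sub (by simp [Matrix.IsHermitian])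
  rw [hB.posSemidef_iff_eigenvalues_nonneg]
  intro i
  have h1 := hB.eigenvalues_mem_spectrum_real i
  have h2 : minEigenvalue hA • (1 : Matrix (Fin p) (Fin p) ℝ)
      = algebraMap ℝ _ (minEigenvalue hA) := (Algebra.algebraMap_eq_smul_one _).symm
  rw [spectrum.mem_iff] at h1
  have h3 : hB.eigenvalues i + minEigenvalue hA ∈ spectrum ℝ A := by
    rw [spectrum.mem_iff, map_add, ← h2]
    convert h1 using 2
    abel
  rw [hA.spectrum_real_eq_range_eigenvalues] at h3
  obtain ⟨j, hj⟩ := h3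
  have h4 : minEigenvalue hA ≤ hA.eigenvalues j := ciInf_le (Set.finite_range _).bddBelow j
  simp only [Pi.zero_apply]
  linarith

/-- Summed over the eigenvalues, this is `log x ≤ x - 1` with its equality case. -/
theorem log_det_le_trace_sub_card {H : Matrix ι ι ℝ} (hH : H.PosDef) :
    Real.log H.det ≤ H.trace - Fintype.card ι ∧
      (H.trace - Fintype.card ι ≤ Real.log H.det → H = 1) := by
  have hpos := hH.eigenvalues_pos
  have hdet : Real.log H.det = ∑ i, Real.log (hH.1.eigenvalues i) := by
    rw [hH.1.det_eq_prod_eigenvalues]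
    simp only [RCLike.ofReal_real_eq_id, id_eq]
    exact Real.log_prod fun i _ => (hpos i).ne'
  have htr : H.trace - Fintype.card ι = ∑ i, (hH.1.eigenvalues i - 1) := by
    rw [hH.1.trace_eq_sum_eigenvalues]
    simp
  have hle : ∀ i, Real.log (hH.1.eigenvalues i) ≤ hH.1.eigenvalues i - 1 := fun i =>
    Real.log_le_sub_one_of_pos (hpos i)
  rw [hdet, htr]
  refine ⟨Finset.sum_le_sum fun i _ => hle i, fun h => ?_⟩
  have heq := (Finset.sum_eq_sum_iff_of_le fun i _ => hle i).1
    (le_antisymm (Finset.sum_le_sum fun i _ => hle i) h)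
  have hone : ∀ i, hH.1.eigenvalues i = 1 := by
    intro i
    by_contra hne
    exact (Real.log_lt_sub_one_of_pos (hpos i) hne).ne (heq i (Finset.mem_univ i))
  rw [hH.1.spectral_theorem]
  have : (RCLike.ofReal ∘ hH.1.eigenvalues : ι → ℝ) = fun _ => 1 := by
    ext i; simp [hone i]
  rw [this, show (Matrix.diagonal fun _ : ι => (1 : ℝ)) = 1 from Matrix.diagonal_one, map_one]

/-- `log det` lies below its tangent at `B`, and touches it only at `B`. -/
theorem log_det_le_tangent {A B : Matrix ι ι ℝ} (hA : A.PosDef) (hB : B.PosDef) :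
    Real.log A.det ≤ Real.log B.det + (B⁻¹ * (A - B)).trace ∧
      (Real.log B.det + (B⁻¹ * (A - B)).trace ≤ Real.log A.det → A = B) := by
  obtain ⟨C, hC⟩ : ∃ C : Matrix ι ι ℝ, B⁻¹ = Cᴴ * C := by
    obtain ⟨C, hC⟩ := CStarAlgebra.nonneg_iff_eq_star_mul_self.1 hB.inv.posSemidef.nonneg
    exact ⟨C, hC⟩
  have hBu : IsUnit B.det := hB.det_pos.ne'.isUnit
  have hCu : IsUnit C := by
    have h : IsUnit (Cᴴ * C) := hC ▸ hB.inv.isUnit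
    rw [Matrix.isUnit_iff_isUnit_det] at h ⊢
    rw [Matrix.det_mul] at h
    exact isUnit_of_mul_isUnit_right h
  have hH : (C * A * Cᴴ).PosDef :=
    hA.mul_mul_conjTranspose_same (Matrix.vecMul_injective_iff_isUnit.2 hCu)
  have htr : (C * A * Cᴴ).trace = (B⁻¹ * A).trace := by
    rw [Matrix.mul_assoc, Matrix.trace_mul_comm, Matrix.mul_assoc, ← hC, Matrix.trace_mul_comm]
  have htr2 : (B⁻¹ * (A - B)).trace = (B⁻¹ * A).trace - Fintype.card ι := by
    rw [Matrix.mul_sub, Matrix.trace_sub, Matrix.nonsing_inv_mul _ hBu, Matrix.trace_one]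
  have hdet : Real.log (C * A * Cᴴ).det = Real.log A.det - Real.log B.det := by
    have : (C * A * Cᴴ).det = A.det / B.det := by
      rw [Matrix.det_mul, Matrix.det_mul, mul_comm C.det, mul_assoc, mul_comm C.det,
        ← Matrix.det_mul, ← hC, Matrix.det_nonsing_inv, Ring.inverse_eq_inv', div_eq_mul_inv]
    rw [this, Real.log_div hA.det_pos.ne' hB.det_pos.ne']
  obtain ⟨h1, h2⟩ := log_det_le_trace_sub_card hH
  rw [hdet, htr] at h1 h2
  rw [htr2]
  refine ⟨by linarith, fun h => ?_⟩
  have h3 : C * (A * Cᴴ) = 1 := by rw [← Matrix.mul_assoc]; exact h2 (by linarith)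
  have h4 : A * (Cᴴ * C) = 1 := by
    rw [← Matrix.mul_assoc]; exact mul_eq_one_comm.1 h3
  rw [← hC] at h4
  calc A = A * B⁻¹ * B := by rw [Matrix.mul_assoc, Matrix.nonsing_inv_mul _ hBu, Matrix.mul_one]
    _ = B := by rw [h4, Matrix.one_mul]

end LinearAlgebra

/-! ### Inverses of diagonal matrices with a small off-diagonal perturbation -/

section Neumann

open Matrix

attribute [local instance] Matrix.linftyOpNormedRing

variable {ι : Type*} [Fintype ι] [DecidableEq ι]

theorem sum_abs_row_le_linfty_opNorm (A : Matrix ι ι ℝ) (i : ι) : ∑ j, |A i j| ≤ ‖A‖ := by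
  rw [Matrix.linfty_opNorm_def]
  have h := Finset.le_sup (f := fun i => ∑ j, ‖A i j‖₊) (Finset.mem_univ i)
  have h' : ((∑ j, ‖A i j‖₊ : NNReal) : ℝ) = ∑ j, |A i j| := by
    simp [Real.norm_eq_abs]
  rw [← h']
  exact_mod_cast h

theorem linfty_opNorm_le_of_sum_abs_row_le {A : Matrix ι ι ℝ} {r : ℝ} (hr : 0 ≤ r)
    (h : ∀ i, ∑ j, |A i j| ≤ r) : ‖A‖ ≤ r := by
  rw [Matrix.linfty_opNorm_def]
  lift r to NNReal using hr
  rw [NNReal.coe_le_coe]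
  refine Finset.sup_le fun i _ => ?_
  rw [← NNReal.coe_le_coe]
  simpa [Real.norm_eq_abs] using h i

theorem linfty_opNorm_diagonal_le {v : ι → ℝ} {B : ℝ} (hB : 0 ≤ B) (h : ∀ i, |v i| ≤ B) :
    ‖(Matrix.diagonal v : Matrix ι ι ℝ)‖ ≤ B := by
  refine linfty_opNorm_le_of_sum_abs_row_le hB fun i => ?_
  rw [Finset.sum_eq_single i]
  · simpa using h i
  · intro j _ hj
    simp [Matrix.diagonal_apply_ne' _ hj]
  · simp

theorem abs_mul_apply_le (A F : Matrix ι ι ℝ) {l : ℝ} (hl : ∀ i j, |F i j| ≤ l) (i j : ι) :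
    |(A * F) i j| ≤ ‖A‖ * l := by
  rw [Matrix.mul_apply]
  refine (Finset.abs_sum_le_sum_abs _ _).trans ?_
  have hl0 : 0 ≤ l := (abs_nonneg _).trans (hl i j)
  calc ∑ k, |A i k * F k j| ≤ ∑ k, |A i k| * l := by
        refine Finset.sum_le_sum fun k _ => ?_
        rw [abs_mul]
        exact mul_le_mul_of_nonneg_left (hl k j) (abs_nonneg _)
    _ = (∑ k, |A i k|) * l := by rw [Finset.sum_mul]
    _ ≤ ‖A‖ * l := mul_le_mul_of_nonneg_right (sum_abs_row_le_linfty_opNorm A i) hl0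

variable {v : ι → ℝ} {F : Matrix ι ι ℝ} {B r l : ℝ}

/-- A symmetric perturbation of the diagonal matrix with entries `1 / v i ≥ 1 / B` whose row sums
stay below `1 / (2 * B)` is positive definite. -/
theorem posDef_diagonal_inv_add (hB : 0 < B) (hv : ∀ i, 0 < v i) (hvB : ∀ i, v i ≤ B)
    (hF : F.IsHermitian) (hF0 : ∀ i, F i i = 0) (hr : ∀ i, ∑ j, |F i j| ≤ r)
    (hrB : r * B ≤ 1 / 2) : (Matrix.diagonal (fun i => (v i)⁻¹) + F).PosDef := by
  refine posDef_of_sum_row_lt_diag ((Matrix.isHermitian_diagonal _).add hF) fun i => ?_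
  have h1 : ∑ j ∈ Finset.univ.erase i, |(Matrix.diagonal (fun i => (v i)⁻¹) + F) i j|
      ≤ ∑ j, |F i j| := by
    refine (Finset.sum_le_sum fun j hj => ?_).trans
      (Finset.sum_le_sum_of_subset_of_nonneg (Finset.erase_subset i _) fun j _ _ => abs_nonneg _)
    rw [Matrix.add_apply, Matrix.diagonal_apply_ne' _ (Finset.ne_of_mem_erase hj), zero_add]
  have h2 : B⁻¹ ≤ (v i)⁻¹ := inv_anti₀ (hv i) (hvB i)
  have h3 : r < B⁻¹ := by
    rw [← one_div, lt_div_iff₀ hB]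
    linarith
  rw [Matrix.add_apply, Matrix.diagonal_apply_eq, hF0, add_zero]
  exact (h1.trans (hr i)).trans_lt (h3.trans_le h2)

/-- The second-order Neumann expansion, with its exact remainder, of the inverse of
`diagonal (1 / v) + F`. -/
theorem inv_diagonal_inv_add_eq (hv : ∀ i, 0 < v i)
    (hu : IsUnit (Matrix.diagonal (fun i => (v i)⁻¹) + F).det) :
    (Matrix.diagonal (fun i => (v i)⁻¹) + F)⁻¹ =
        diagonal v - diagonal v * F * (Matrix.diagonal (fun i => (v i)⁻¹) + F)⁻¹ ∧
    (Matrix.diagonal (fun i => (v i)⁻¹) + F)⁻¹ = diagonal v - diagonal v * F * diagonal v +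
      diagonal v * (F * (Matrix.diagonal (fun i => (v i)⁻¹) + F)⁻¹ * F) * diagonal v := by
  set D := Matrix.diagonal (fun i => (v i)⁻¹) with hD
  set M := (D + F)⁻¹ with hM
  set V := Matrix.diagonal v with hV
  have hVD : V * D = 1 := by
    rw [hV, hD, Matrix.diagonal_mul_diagonal, ← Matrix.diagonal_one]
    congr 1; ext i; exact mul_inv_cancel₀ (hv i).ne'
  have hDV : D * V = 1 := mul_eq_one_comm.1 hVD
  have h1 : (D + F) * M = 1 := Matrix.mul_nonsing_inv _ hu
  have h2 : M * (D + F) = 1 := Matrix.nonsing_inv_mul _ hu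
  have e1 : M = V - V * F * M := by
    have : V * ((D + F) * M) = V := by rw [h1, Matrix.mul_one]
    rw [← Matrix.mul_assoc, Matrix.mul_add, hVD, Matrix.add_mul, Matrix.one_mul] at this
    rw [eq_sub_iff_add_eq, this]
  have e2 : M = V - M * F * V := by
    have : (M * (D + F)) * V = V := by rw [h2, Matrix.one_mul]
    rw [Matrix.mul_assoc, Matrix.add_mul, hDV, Matrix.mul_add, Matrix.mul_one,
      ← Matrix.mul_assoc] at this
    rw [eq_sub_iff_add_eq, this]
  refine ⟨e1, ?_⟩
  calc M = V - V * F * M := e1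
    _ = V - V * F * (V - M * F * V) := by rw [← e2]
    _ = _ := by noncomm_ring

theorem linfty_opNorm_inv_le (hB : 0 < B) (hv : ∀ i, 0 < v i) (hvB : ∀ i, v i ≤ B)
    (hr0 : 0 ≤ r) (hr : ∀ i, ∑ j, |F i j| ≤ r) (hrB : r * B ≤ 1 / 2)
    (hu : IsUnit (Matrix.diagonal (fun i => (v i)⁻¹) + F).det) :
    ‖(Matrix.diagonal (fun i => (v i)⁻¹) + F)⁻¹‖ ≤ 2 * B := by
  have h1 := (inv_diagonal_inv_add_eq hv hu).1
  set M := (Matrix.diagonal (fun i => (v i)⁻¹) + F)⁻¹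
  have hV : ‖diagonal v‖ ≤ B :=
    linfty_opNorm_diagonal_le hB.le fun i => by rw [abs_of_pos (hv i)]; exact hvB i
  have hF : ‖F‖ ≤ r := linfty_opNorm_le_of_sum_abs_row_le hr0 hr
  have h2 : ‖M‖ ≤ B + B * r * ‖M‖ := by
    calc ‖M‖ = ‖diagonal v - diagonal v * F * M‖ := by rw [← h1]
      _ ≤ ‖diagonal v‖ + ‖diagonal v * F * M‖ := norm_sub_le _ _
      _ ≤ ‖diagonal v‖ + ‖diagonal v‖ * ‖F‖ * ‖M‖ := by
        gcongr
        exact (norm_mul_le _ _).trans (by gcongr; exact norm_mul_le _ _)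
      _ ≤ B + B * r * ‖M‖ := by gcongr
  nlinarith [norm_nonneg M]

theorem inv_apply_eq (hv : ∀ i, 0 < v i)
    (hu : IsUnit (Matrix.diagonal (fun i => (v i)⁻¹) + F).det) (i j : ι) :
    (Matrix.diagonal (fun i => (v i)⁻¹) + F)⁻¹ i j =
      diagonal v i j - v i * F i j * v j +
        v i * (F * (Matrix.diagonal (fun i => (v i)⁻¹) + F)⁻¹ * F) i j * v j := by
  conv_lhs => rw [(inv_diagonal_inv_add_eq hv hu).2]
  simp only [Matrix.add_apply, Matrix.sub_apply, Matrix.mul_diagonal, Matrix.diagonal_mul]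

/-- Entries and row sums of the second-order remainder `F (D + F)⁻¹ F`. -/
theorem remainder_bounds (hB : 0 < B) (hv : ∀ i, 0 < v i) (hvB : ∀ i, v i ≤ B)
    (hr0 : 0 ≤ r) (hr : ∀ i, ∑ j, |F i j| ≤ r) (hrB : r * B ≤ 1 / 2)
    (hl : ∀ i j, |F i j| ≤ l)
    (hu : IsUnit (Matrix.diagonal (fun i => (v i)⁻¹) + F).det) :
    (∀ i j, |(F * (Matrix.diagonal (fun i => (v i)⁻¹) + F)⁻¹ * F) i j| ≤ 2 * B * r * l) ∧
    ∀ i, ∑ j, |(F * (Matrix.diagonal (fun i => (v i)⁻¹) + F)⁻¹ * F) i j| ≤ 2 * B * r ^ 2 := by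
  have hM := linfty_opNorm_inv_le hB hv hvB hr0 hr hrB hu
  set M := (Matrix.diagonal (fun i => (v i)⁻¹) + F)⁻¹
  have hF : ‖F‖ ≤ r := linfty_opNorm_le_of_sum_abs_row_le hr0 hr
  have hFM : ‖F * M‖ ≤ 2 * B * r := by
    calc ‖F * M‖ ≤ ‖F‖ * ‖M‖ := norm_mul_le _ _
      _ ≤ r * (2 * B) := by gcongr
      _ = 2 * B * r := by ring
  refine ⟨fun i j => (abs_mul_apply_le _ F hl i j).trans ?_, fun i =>
    (sum_abs_row_le_linfty_opNorm _ i).trans ?_⟩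
  · exact mul_le_mul_of_nonneg_right hFM ((abs_nonneg _).trans (hl i j))
  · calc ‖F * M * F‖ ≤ ‖F * M‖ * ‖F‖ := norm_mul_le _ _
      _ ≤ (2 * B * r) * r := by gcongr
      _ = 2 * B * r ^ 2 := by ring

end Neumann

/-! ### Prescribing the diagonal of the inverse -/

section DiagonalFit

open Matrix

variable {ι : Type*} [Fintype ι] [DecidableEq ι]

/-- The matrix determinant lemma for a change of one diagonal entry. -/
theorem det_add_single {J : Matrix ι ι ℝ} (hJ : IsUnit J.det) (i : ι) (t : ℝ) :
    (J + Matrix.single i i t).det = J.det * (1 + t * J⁻¹ i i) := by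
  have h1 : Matrix.single i i t = replicateCol Unit (Pi.single i t) *
      replicateRow Unit (Pi.single i (1 : ℝ)) := by
    ext a b
    simp only [Matrix.single_apply, Matrix.mul_apply, replicateCol_apply, replicateRow_apply,
      Finset.univ_unique, Finset.sum_const, Finset.card_singleton, one_smul, Pi.single_apply]
    split_ifs <;> grind
  rw [h1, det_add_replicateCol_mul_replicateRow hJ]
  congr 1
  rw [det_unique (n := Unit), Matrix.add_apply, Matrix.one_apply_eq]
  simp [Matrix.mul_apply, Pi.single_apply, mul_comm]

/-- The one-sided first-order condition at `t = 0`, applied to each coordinate of a minimiser. -/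
theorem le_of_log_one_add_mul_le {m s ε : ℝ} (hε : 0 < ε)
    (h : ∀ t, 0 < t → t < ε → Real.log (1 + t * m) ≤ t * s) : m ≤ s := by
  have hd : HasDerivAt (fun t : ℝ => t * s - Real.log (1 + t * m)) (s - m) 0 := by
    have h1 : HasDerivAt (fun t : ℝ => 1 + t * m) m 0 := by
      simpa using ((hasDerivAt_id (0 : ℝ)).mul_const m).const_add 1
    have h2 := h1.log (by simp)
    have h3 : HasDerivAt (fun t : ℝ => t * s) s 0 := by
      simpa using (hasDerivAt_id (0 : ℝ)).mul_const s
    simpa using! h3.sub h2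
  have hslope := hd.tendsto_slope_zero_right
  have : 0 ≤ s - m := by
    refine ge_of_tendsto hslope ?_
    filter_upwards [Ioo_mem_nhdsGT hε] with t ht
    have := h t ht.1 ht.2
    have ht0 := ht.1
    simp only [zero_add, zero_mul, add_zero, Real.log_one, sub_zero, smul_eq_mul]
    exact mul_nonneg (inv_nonneg.2 ht0.le) (by linarith)
  linarith

/-- A diagonal can be added to a small symmetric `F` so that the inverse of the sum has a
prescribed diagonal `s`. The diagonal minimises `w ↦ ∑ i, s i * w i - log det (diagonal w + F)` over
the box `1 / (2 s i) ≤ w i ≤ 2 / s i`; the second-order expansion of the inverse shows that no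
coordinate of the minimiser lies on the boundary, so the gradient, `s` minus the diagonal of the
inverse, vanishes there. -/
theorem exists_diagonal_inv_diag_eq {F : Matrix ι ι ℝ} {s : ι → ℝ} {B r : ℝ} (hB : 0 < B)
    (hs : ∀ i, 0 < s i) (hsB : ∀ i, 2 * s i ≤ B)
    (hF : F.IsHermitian) (hF0 : ∀ i, F i i = 0) (hr0 : 0 ≤ r) (hr : ∀ i, ∑ j, |F i j| ≤ r)
    (hrB : r * B ≤ 1 / 2) :
    ∃ v : ι → ℝ, (∀ i, 0 < v i) ∧ (∀ i, v i ≤ B) ∧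
      ∀ i, (Matrix.diagonal (fun i => (v i)⁻¹) + F)⁻¹ i i = s i := by
  set a : ι → ℝ := fun i => (2 * s i)⁻¹ with ha
  set b : ι → ℝ := fun i => 2 * (s i)⁻¹ with hb
  have ha0 : ∀ i, 0 < a i := fun i => by have := hs i; simp only [ha]; positivity
  have hab : ∀ i, a i < b i := fun i => by
    have := inv_pos.2 (hs i)
    simp only [ha, hb, mul_inv]; linarith
  have hpos : ∀ w ∈ Set.Icc a b, (∀ i, 0 < (w i)⁻¹) ∧ (∀ i, (w i)⁻¹ ≤ B) ∧
      (Matrix.diagonal w + F).PosDef := by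
    intro w hw
    have h0 : ∀ i, 0 < w i := fun i => (ha0 i).trans_le (hw.1 i)
    have h1 : ∀ i, 0 < (w i)⁻¹ := fun i => inv_pos.2 (h0 i)
    have h2 : ∀ i, (w i)⁻¹ ≤ B := fun i => by
      refine le_trans ?_ (hsB i)
      rw [inv_le_comm₀ (h0 i) (by have := hs i; positivity)]
      exact hw.1 i
    refine ⟨h1, h2, ?_⟩
    have := posDef_diagonal_inv_add hB h1 h2 hF hF0 hr hrB
    simpa using this
  obtain ⟨w, hw, hmin⟩ : ∃ w ∈ Set.Icc a b, IsMinOn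
      (fun w : ι → ℝ => ∑ i, s i * w i - Real.log (Matrix.diagonal w + F).det)
      (Set.Icc a b) w := by
    refine isCompact_Icc.exists_isMinOn ⟨a, le_rfl, fun i => (hab i).le⟩ ?_
    refine ContinuousOn.sub (Continuous.continuousOn (by fun_prop)) ?_
    refine ContinuousOn.log (Continuous.continuousOn ?_) fun w hw => (hpos w hw).2.2.det_pos.ne'
    exact ((continuous_id.matrix_diagonal).add continuous_const).matrix_det
  obtain ⟨hv, hvB, hpd⟩ := hpos w hw
  have hdd : Matrix.diagonal (fun i => ((fun i => (w i)⁻¹) i)⁻¹) = Matrix.diagonal w := by simp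
  refine ⟨fun i => (w i)⁻¹, hv, hvB, ?_⟩
  have hu : IsUnit (Matrix.diagonal (fun i => ((fun i => (w i)⁻¹) i)⁻¹) + F).det := by
    rw [hdd]; exact hpd.det_pos.ne'.isUnit
  have hM := fun i => inv_apply_eq hv hu i i
  have hQ := (remainder_bounds hB hv hvB hr0 hr hrB (l := r) (fun i j =>
    (Finset.single_le_sum (f := fun j => |F i j|) (fun j _ => abs_nonneg _)
      (Finset.mem_univ j)).trans (hr i)) hu).1
  simp only [hdd] at hM hQ ⊢
  set M := (Matrix.diagonal w + F)⁻¹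
  have hMpd : M.PosDef := hpd.inv
  have hQ0 : ∀ i, 0 ≤ (F * M * F) i i := fun i => by
    have := (hMpd.posSemidef.mul_mul_conjTranspose_same F)
    rw [hF.eq] at this
    exact this.diag_nonneg
  -- the objective along a coordinate direction
  have hstep : ∀ i t, a i ≤ w i + t → w i + t ≤ b i → Real.log (1 + t * M i i) ≤ t * s i := by
    intro i t h1 h2
    set w' : ι → ℝ := fun k => if k = i then w k + t else w k with hw'
    have hw'm : w' ∈ Set.Icc a b := by
      constructor <;> intro k <;> by_cases hk : k = i <;> simp only [hw', hk, if_true, if_false]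
      · exact h1
      · exact hw.1 k
      · exact h2
      · exact hw.2 k
    have h3 := hmin hw'm
    simp only [Set.mem_ofPred_eq] at h3
    have h4 : Matrix.diagonal w' + F = (Matrix.diagonal w + F) + Matrix.single i i t := by
      ext k l
      simp only [Matrix.add_apply, Matrix.diagonal_apply, Matrix.single_apply, hw']
      split_ifs <;> grind
    have h5 : ∑ k, s k * w' k = ∑ k, s k * w k + s i * t := by
      have : ∀ k, s k * w' k = s k * w k + if k = i then s i * t else 0 := by
        intro k
        simp only [hw']
        split_ifs with hk
        · subst hk; ring
        · ring
      simp [this, Finset.sum_add_distrib]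
    have h6 := (hpos w' hw'm).2.2.det_pos
    rw [h4, det_add_single hpd.det_pos.ne'.isUnit] at h6
    have h7 : 0 < 1 + t * M i i := (mul_pos_iff_of_pos_left hpd.det_pos).1 h6
    rw [h4, h5, det_add_single hpd.det_pos.ne'.isUnit,
      Real.log_mul hpd.det_pos.ne' h7.ne'] at h3
    linarith
  have hle : ∀ i, w i < b i → M i i ≤ s i := fun i hi =>
    le_of_log_one_add_mul_le (ε := b i - w i) (by linarith) fun t ht0 ht =>
      hstep i t (by linarith [hw.1 i]) (by linarith)
  have hge : ∀ i, a i < w i → s i ≤ M i i := fun i hi => by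
    have := le_of_log_one_add_mul_le (m := - M i i) (s := - s i) (ε := w i - a i) (by linarith)
      fun t ht0 ht => by
        have := hstep i (-t) (by linarith) (by linarith [hw.2 i])
        simpa using this
    linarith
  -- at either end of the box the second-order expansion contradicts the one-sided condition
  intro i
  have hFi := hM i
  rw [hF0, Matrix.diagonal_apply_eq] at hFi
  have hvi := hv i
  rcases eq_or_lt_of_le (hw.2 i) with hwb | hwb
  · exfalso
    have h1 := hge i (hwb ▸ hab i)
    have h2 : (w i)⁻¹ = s i / 2 := by rw [hwb]; simp only [hb]; field_simp
    have h3 : (F * M * F) i i ≤ 2 * B * r * r := (le_abs_self _).trans (hQ i i)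
    have h4 : (w i)⁻¹ * (F * M * F) i i ≤ 1 / 2 := by
      calc (w i)⁻¹ * (F * M * F) i i ≤ B * (2 * B * r * r) :=
            mul_le_mul (hvB i) h3 (hQ0 i) hB.le
        _ = 2 * (r * B) ^ 2 := by ring
        _ ≤ 2 * (1 / 2) ^ 2 := by gcongr
        _ = 1 / 2 := by norm_num
    have h5 : (w i)⁻¹ * (F * M * F) i i * (w i)⁻¹ ≤ 1 / 2 * (w i)⁻¹ :=
      mul_le_mul_of_nonneg_right h4 hvi.le
    have := hs i
    rw [h2] at h5 hFi
    linarith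
  · refine le_antisymm (hle i hwb) ?_
    rcases eq_or_lt_of_le (hw.1 i) with hwa | hwa
    · have h2 : (w i)⁻¹ = 2 * s i := by rw [← hwa]; simp only [ha, inv_inv]
      have h5 : 0 ≤ (w i)⁻¹ * (F * M * F) i i * (w i)⁻¹ := by
        have := hQ0 i; positivity
      have := hs i
      rw [h2] at h5 hFi
      linarith
    · exact hge i hwa

end DiagonalFit

/-! ### Optimality conditions for the primal and the dual program -/

section KKT

variable {p : ℕ}

/-- The Karush–Kuhn–Tucker conditions for `J` and `(J⁻¹, R)`: with `Z = J⁻¹ - S - R`, the residual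
`Z` is `γ` times a subgradient of the off-diagonal `ℓ¹` norm at `J`, and `R` is a multiplier of the
box constraint, aligned with `J` and supported where `|J i j| = lam`. -/
structure IsKKTPair (S : Matrix (Fin p) (Fin p) ℝ) (γ lam : ℝ)
    (J R : Matrix (Fin p) (Fin p) ℝ) : Prop where
  posDef : J.PosDef
  posDef_sub : (J⁻¹ - R).PosDef
  diag : ∀ i, J⁻¹ i i = S i i
  diag_R : ∀ i, R i i = 0
  bounded : ∀ i j, i ≠ j → |J i j| ≤ lam
  fit : ∀ i j, i ≠ j → |J⁻¹ i j - S i j - R i j| ≤ γ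
  align_R : ∀ i j, i ≠ j → R i j * J i j = lam * |R i j|
  align_Z : ∀ i j, i ≠ j → (J⁻¹ i j - S i j - R i j) * J i j = γ * |J i j|

theorem trace_transpose_mul (A B : Matrix (Fin p) (Fin p) ℝ) :
    (A.transpose * B).trace = ∑ i, ∑ j, A i j * B i j := by
  simp only [Matrix.trace, Matrix.diag_apply, Matrix.mul_apply, Matrix.transpose_apply]
  exact Finset.sum_comm

theorem trace_mul_of_isHermitian {A : Matrix (Fin p) (Fin p) ℝ} (hA : A.IsHermitian)
    (B : Matrix (Fin p) (Fin p) ℝ) : (A * B).trace = ∑ i, ∑ j, A i j * B i j := by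
  rw [← trace_transpose_mul]
  congr 2
  exact hA.eq.symm

theorem mul_le_mul_abs {x y b : ℝ} (h : |x| ≤ b) : x * y ≤ b * |y| :=
  (le_abs_self _).trans (by rw [abs_mul]; exact mul_le_mul_of_nonneg_right h (abs_nonneg _))

variable {S J R : Matrix (Fin p) (Fin p) ℝ} {γ lam : ℝ}

theorem IsKKTPair.primalOptimal (h : IsKKTPair S γ lam J R) (hlam : 0 ≤ lam) :
    PrimalOptimal S γ lam J := by
  refine ⟨⟨h.posDef, (offLinf_le_iff _ hlam).2 h.bounded⟩, fun J' hJ' => ?_⟩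
  have h1 := (log_det_le_tangent hJ'.posDef h.posDef).1
  have hb := (offLinf_le_iff _ hlam).1 hJ'.bounded
  rw [trace_mul_of_isHermitian h.posDef.inv.1] at h1
  have h2 : ∑ i, ∑ j, (S i j * J i j + γ * (if i = j then 0 else |J i j|)) +
      ∑ i, ∑ j, J⁻¹ i j * (J' - J) i j ≤
      ∑ i, ∑ j, (S i j * J' i j + γ * (if i = j then 0 else |J' i j|)) := by
    simp only [← Finset.sum_add_distrib]
    refine Finset.sum_le_sum fun i _ => Finset.sum_le_sum fun j _ => ?_
    rw [Matrix.sub_apply]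
    split_ifs with hij
    · subst hij
      rw [h.diag]
      linarith
    · have e1 := mul_le_mul_abs (y := R i j) (hb i j hij)
      have e2 := mul_le_mul_abs (y := J' i j) (h.fit i j hij)
      have e3 := h.align_R i j hij
      have e4 := h.align_Z i j hij
      linarith
  simp only [Finset.sum_add_distrib, ← Finset.mul_sum] at h2
  unfold primalObjective offL1
  rw [trace_transpose_mul, trace_transpose_mul]
  linarith

theorem IsKKTPair.dualFeasible (h : IsKKTPair S γ lam J R) (hγ : 0 ≤ γ) :
    DualFeasible S γ J⁻¹ R where
  fit := (offLinf_le_iff _ hγ).2 fun i j hij => by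
    have := h.fit i j hij
    rw [Matrix.add_apply, Matrix.sub_apply, ← abs_neg]
    convert this using 2
    ring
  diag_M := h.diag
  diag_R := h.diag_R
  posDef_M := h.posDef.inv
  posDef_sub := h.posDef_sub

/-- Weak duality against a feasible dual point, entrywise: the objective gap is
`lam |R'| - J R'` plus `γ |J| - J Z'`, both nonnegative. -/
theorem IsKKTPair.dual_gap (h : IsKKTPair S γ lam J R) (hγ : 0 ≤ γ)
    {M' R' : Matrix (Fin p) (Fin p) ℝ} (h' : DualFeasible S γ M' R') (i j : Fin p) :
    J i j * (M' - J⁻¹) i j + (lam * if i = j then 0 else |R i j|) ≤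
        (lam * if i = j then 0 else |R' i j|) ∧
    ((lam * if i = j then 0 else |R' i j|) ≤
        J i j * (M' - J⁻¹) i j + (lam * if i = j then 0 else |R i j|) → i ≠ j →
      J i j * R' i j = lam * |R' i j| ∧ J i j * (M' i j - S i j - R' i j) = γ * |J i j|) := by
  rw [Matrix.sub_apply]
  by_cases hij : i = j
  · subst hij
    rw [h.diag, h'.diag_M]
    simp
  · simp only [if_neg hij]
    have hf : |M' i j - S i j - R' i j| ≤ γ := by
      have := (offLinf_le_iff _ hγ).1 h'.fit i j hij
      rw [Matrix.add_apply, Matrix.sub_apply, ← abs_neg] at this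
      convert this using 2
      ring
    have e1 := mul_le_mul_abs (y := R' i j) (h.bounded i j hij)
    have e2 := mul_le_mul_abs (y := J i j) hf
    have e3 := h.align_R i j hij
    have e4 := h.align_Z i j hij
    refine ⟨by linarith, fun hle _ => ⟨by linarith, by linarith⟩⟩

theorem IsKKTPair.dualObjective_le (h : IsKKTPair S γ lam J R) (hγ : 0 ≤ γ)
    {M' R' : Matrix (Fin p) (Fin p) ℝ} (h' : DualFeasible S γ M' R') :
    dualObjective lam M' R' ≤ dualObjective lam J⁻¹ R := by
  have hJJ : J⁻¹⁻¹ = J := Matrix.nonsing_inv_nonsing_inv _ h.posDef.det_pos.ne'.isUnit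
  have h1 := (log_det_le_tangent h'.posDef_M h.posDef.inv).1
  rw [hJJ, trace_mul_of_isHermitian h.posDef.1] at h1
  have h2 := Finset.sum_le_sum fun i (_ : i ∈ Finset.univ) =>
    Finset.sum_le_sum fun j (_ : j ∈ Finset.univ) => (h.dual_gap hγ h' i j).1
  simp only [Finset.sum_add_distrib, ← Finset.mul_sum] at h2
  unfold dualObjective offL1
  linarith

theorem IsKKTPair.dualOptimal (h : IsKKTPair S γ lam J R) (hγ : 0 ≤ γ) :
    DualOptimal S γ lam J⁻¹ R :=
  ⟨h.dualFeasible hγ, fun _ _ h' => h.dualObjective_le hγ h'⟩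

/-- Strict concavity of `log det` forces `Σ_M = J⁻¹`; complementary slackness then pins `Σ_R`:
it vanishes where `J` does, and elsewhere the residual is `γ` times the sign of `J`. -/
theorem IsKKTPair.dual_unique (h : IsKKTPair S γ lam J R) (hγ : 0 ≤ γ)
    (hlam : ∀ i j : Fin p, i ≠ j → 0 < lam)
    {M' R' : Matrix (Fin p) (Fin p) ℝ} (h' : DualOptimal S γ lam M' R') : M' = J⁻¹ ∧ R' = R := by
  have hJJ : J⁻¹⁻¹ = J := Matrix.nonsing_inv_nonsing_inv _ h.posDef.det_pos.ne'.isUnit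
  have hopt := h'.2 _ _ (h.dualFeasible hγ)
  obtain ⟨h1, h1'⟩ := log_det_le_tangent h'.1.posDef_M h.posDef.inv
  rw [hJJ, trace_mul_of_isHermitian h.posDef.1] at h1 h1'
  have h2 := Finset.sum_le_sum fun i (_ : i ∈ Finset.univ) =>
    Finset.sum_le_sum fun j (_ : j ∈ Finset.univ) => (h.dual_gap hγ h'.1 i j).1
  have h3 := h2
  simp only [Finset.sum_add_distrib, ← Finset.mul_sum] at h3
  unfold dualObjective offL1 at hopt
  have hM : M' = J⁻¹ := h1' (by linarith)
  have heq : ∀ i j, (lam * if i = j then 0 else |R' i j|) ≤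
      J i j * (M' - J⁻¹) i j + (lam * if i = j then 0 else |R i j|) := by
    have h4 : ∑ i, ∑ j, (J i j * (M' - J⁻¹) i j + (lam * if i = j then 0 else |R i j|)) =
        ∑ i, ∑ j, (lam * if i = j then 0 else |R' i j|) := by
      refine le_antisymm h2 ?_
      simp only [Finset.sum_add_distrib, ← Finset.mul_sum]
      linarith
    intro i j
    have h5 := (Finset.sum_eq_sum_iff_of_le fun i _ =>
      Finset.sum_le_sum fun j _ => (h.dual_gap hγ h'.1 i j).1).1 h4 i (Finset.mem_univ i)
    exact ((Finset.sum_eq_sum_iff_of_le fun j _ => (h.dual_gap hγ h'.1 i j).1).1 h5 j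
      (Finset.mem_univ j)).ge
  refine ⟨hM, ?_⟩
  ext i j
  by_cases hij : i = j
  · subst hij
    rw [h.diag_R, h'.1.diag_R]
  · obtain ⟨e1, e2⟩ := (h.dual_gap hγ h'.1 i j).2 (heq i j) hij
    have e3 := h.align_R i j hij
    have e4 := h.align_Z i j hij
    have hl := hlam i j hij
    rw [hM] at e2
    by_cases hJ0 : J i j = 0
    · rw [hJ0] at e1 e3
      have f1 : |R' i j| = 0 := by
        refine (mul_eq_zero.1 (?_ : lam * |R' i j| = 0)).resolve_left hl.ne'
        linarith
      have f2 : |R i j| = 0 := by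
        refine (mul_eq_zero.1 (?_ : lam * |R i j| = 0)).resolve_left hl.ne'
        linarith
      rw [abs_eq_zero.1 f1, abs_eq_zero.1 f2]
    · refine mul_left_cancel₀ hJ0 ?_
      linarith

end KKT

/-! ### Recovery from an entrywise accurate sample covariance matrix -/

section Deterministic

variable {p : ℕ}

theorem card_row_support_le_maxDegree {A : Matrix (Fin p) (Fin p) ℝ} (hA : A.IsHermitian)
    (i : Fin p) : (Finset.univ.filter fun j => A i j ≠ 0).card ≤ maxDegree A := by
  have h1 : {j | A j i ≠ 0}.ncard ≤ maxDegree A :=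
    Finset.le_sup (f := fun j => {i | A i j ≠ 0}.ncard) (Finset.mem_univ i)
  refine le_trans (le_of_eq ?_) h1
  rw [← Set.ncard_coe_finset]
  congr 1
  ext j
  simp [← hA.apply i j]

theorem sum_row_support_le {A : Matrix (Fin p) (Fin p) ℝ} (hA : A.IsHermitian) {c : ℝ}
    (hc : 0 ≤ c) (i : Fin p) : ∑ j, (if A i j ≠ 0 then c else 0) ≤ maxDegree A * c := by
  rw [← Finset.sum_filter, Finset.sum_const, nsmul_eq_mul]
  exact mul_le_mul_of_nonneg_right (by exact_mod_cast card_row_support_le_maxDegree hA i) hc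

/-- A symmetric perturbation with row sums below the smallest eigenvalue keeps a matrix positive
definite. -/
theorem posDef_of_row_sum_sub_lt {A N : Matrix (Fin p) (Fin p) ℝ} (hA : A.IsHermitian)
    (hN : N.IsHermitian) (h : ∀ i, ∑ j, |(N - A) i j| < minEigenvalue hA) : N.PosDef := by
  have h1 : (minEigenvalue hA • (1 : Matrix (Fin p) (Fin p) ℝ) + (N - A)).PosDef := by
    refine posDef_of_sum_row_lt_diag
      ((by simp [Matrix.IsHermitian] : Matrix.IsHermitian _).add (hN.sub hA)) fun i => ?_
    have h2 := h i
    rw [← Finset.add_sum_erase _ _ (Finset.mem_univ i)] at h2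
    have h3 : ∑ j ∈ Finset.univ.erase i,
        |(minEigenvalue hA • (1 : Matrix (Fin p) (Fin p) ℝ) + (N - A)) i j| =
        ∑ j ∈ Finset.univ.erase i, |(N - A) i j| := by
      refine Finset.sum_congr rfl fun j hj => ?_
      rw [Matrix.add_apply, Matrix.smul_apply, Matrix.one_apply_ne (Finset.ne_of_mem_erase hj).symm,
        smul_zero, zero_add]
    rw [h3, Matrix.add_apply, Matrix.smul_apply, Matrix.one_apply_eq, smul_eq_mul, mul_one]
    have h4 := neg_abs_le ((N - A) i i)
    linarith
  have h2 := Matrix.PosDef.posSemidef_add (posSemidef_sub_minEigenvalue hA) h1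
  rwa [← add_assoc, sub_add_cancel, add_sub_cancel] at h2

/-- The off-diagonal part of the primal solution: saturated at `∓ lam` against the signs of `A`. -/
noncomputable def saturatedPattern (lam : ℝ) (A : Matrix (Fin p) (Fin p) ℝ) :
    Matrix (Fin p) (Fin p) ℝ :=
  Matrix.of fun i j => if i = j then 0 else -lam * (SignType.sign (A i j) : ℝ)

theorem abs_saturatedPattern_le {lam : ℝ} (hlam : 0 ≤ lam) (A : Matrix (Fin p) (Fin p) ℝ)
    (i j : Fin p) : |saturatedPattern lam A i j| ≤ if A i j ≠ 0 then lam else 0 := by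
  simp only [saturatedPattern, Matrix.of_apply]
  rcases lt_trichotomy (A i j) 0 with h | h | h <;> split_ifs <;> simp_all [abs_of_nonneg]

/-- The box multiplier `Σ_R` for the primal solution with inverse `M`: on the off-diagonal support
of `A` it makes the residual `M - S - R` equal to `-γ` times the sign of `A`; elsewhere it is
zero. -/
noncomputable def boxMultiplier (γ : ℝ) (A S M : Matrix (Fin p) (Fin p) ℝ) :
    Matrix (Fin p) (Fin p) ℝ :=
  Matrix.of fun i j => if i ≠ j ∧ A i j ≠ 0 then
    M i j - S i j + γ * (SignType.sign (A i j) : ℝ) else 0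

theorem boxMultiplier_isHermitian (γ : ℝ) {A S M : Matrix (Fin p) (Fin p) ℝ}
    (hA : A.IsHermitian) (hS : S.IsHermitian) (hM : M.IsHermitian) :
    (boxMultiplier γ A S M).IsHermitian := by
  refine Matrix.IsHermitian.ext fun i j => ?_
  have e1 := hA.apply i j
  have e2 := hS.apply i j
  have e3 := hM.apply i j
  simp only [star_trivial] at e1 e2 e3 ⊢
  simp only [boxMultiplier, Matrix.of_apply, e1, e2, e3, ne_comm (a := j)]

theorem saturatedPattern_isHermitian (lam : ℝ) {A : Matrix (Fin p) (Fin p) ℝ}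
    (hA : A.IsHermitian) : (saturatedPattern lam A).IsHermitian := by
  refine Matrix.IsHermitian.ext fun i j => ?_
  have e1 := hA.apply i j
  simp only [star_trivial] at e1 ⊢
  simp only [saturatedPattern, Matrix.of_apply, e1, eq_comm (a := j)]

/-- If `S` is entrywise within `δ` of `A`, the programs recover the off-diagonal support and signs
of `A`. The quantity `2 * B ^ 3 * (lam * d) * lam` bounds the second-order term of `J⁻¹`; off the
support of `A`, where the first-order term vanishes, it is all of `J⁻¹`. -/
theorem recovers_of_entrywise_close {A S : Matrix (Fin p) (Fin p) ℝ} {γ lam δ B err : ℝ}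
    (hA : A.PosDef) (hS : S.IsHermitian) (hγ : 0 ≤ γ) (hlam0 : 0 ≤ lam)
    (hlam : ∀ i j : Fin p, i ≠ j → 0 < lam) (hB : 0 < B) (hδ : 0 ≤ δ)
    (hclose : ∀ i j, |S i j - A i j| ≤ δ)
    (hSpos : ∀ i, 0 < S i i) (hSB : ∀ i, 2 * S i i ≤ B)
    (hsmall : lam * maxDegree A * B ≤ 1 / 2)
    (hoff : ∀ i j : Fin p, i ≠ j → δ + 2 * B ^ 3 * (lam * maxDegree A) * lam ≤ γ)
    (hmin : ∀ i j : Fin p, i ≠ j → A i j ≠ 0 →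
      γ + δ + B ^ 2 * lam + 2 * B ^ 3 * (lam * maxDegree A) * lam < |A i j|)
    (heig : maxDegree A * (δ + γ) + 2 * B ^ 3 * (lam * maxDegree A) ^ 2 <
      minEigenvalue hA.isHermitian)
    (herr0 : 0 ≤ err) (herr : ∀ i j : Fin p, i ≠ j →
      γ + δ + B ^ 2 * lam + 2 * B ^ 3 * (lam * maxDegree A) * lam ≤ err) :
    Recovers S γ lam err A := by
  have hAh := hA.isHermitian
  set d : ℝ := (maxDegree A : ℝ) with hd
  have hd0 : 0 ≤ d := Nat.cast_nonneg _
  set F := saturatedPattern lam A with hF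
  have hFh : F.IsHermitian := saturatedPattern_isHermitian lam hAh
  have hF0 : ∀ i, F i i = 0 := fun i => by simp [hF, saturatedPattern]
  have hFl : ∀ i j, |F i j| ≤ lam := fun i j =>
    (abs_saturatedPattern_le hlam0 A i j).trans (by split_ifs <;> simp [hlam0])
  have hFr : ∀ i, ∑ j, |F i j| ≤ lam * d := fun i =>
    (Finset.sum_le_sum fun j _ => abs_saturatedPattern_le hlam0 A i j).trans
      ((sum_row_support_le hAh hlam0 i).trans (mul_comm _ _).le)
  have hr0 : 0 ≤ lam * d := mul_nonneg hlam0 hd0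
  obtain ⟨v, hv, hvB, hdiag⟩ :=
    exists_diagonal_inv_diag_eq hB hSpos hSB hFh hF0 hr0 hFr hsmall
  have hJ := posDef_diagonal_inv_add hB hv hvB hFh hF0 hFr hsmall
  have hu := hJ.det_pos.ne'.isUnit
  obtain ⟨hG, hGr⟩ := remainder_bounds hB hv hvB hr0 hFr hsmall hFl hu
  have hMe := inv_apply_eq hv hu
  have hJoff : ∀ i j, i ≠ j → (Matrix.diagonal (fun i => (v i)⁻¹) + F) i j =
      -lam * (SignType.sign (A i j) : ℝ) := by
    intro i j hij
    rw [Matrix.add_apply, Matrix.diagonal_apply_ne _ hij]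
    simp [hF, saturatedPattern, hij]
  set J := Matrix.diagonal (fun i => (v i)⁻¹) + F with hJdef
  have hMh : J⁻¹.IsHermitian := hJ.inv.isHermitian
  set M := J⁻¹ with hM
  set Q := 2 * B ^ 3 * (lam * d) * lam with hQ
  -- size of the entries of `M`
  have hvG : ∀ i j, |v i * (F * M * F) i j * v j| ≤ B ^ 2 * |(F * M * F) i j| := by
    intro i j
    rw [abs_mul, abs_mul, abs_of_pos (hv i), abs_of_pos (hv j)]
    calc v i * |(F * M * F) i j| * v j ≤ B * |(F * M * F) i j| * B := by
          have := hv j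
          have := hvB i
          have := hvB j
          gcongr
      _ = B ^ 2 * |(F * M * F) i j| := by ring
  have hQ' : ∀ i j, B ^ 2 * |(F * M * F) i j| ≤ Q := fun i j => by
    calc B ^ 2 * |(F * M * F) i j| ≤ B ^ 2 * (2 * B * (lam * d) * lam) := by
          have := hG i j
          gcongr
      _ = Q := by rw [hQ]; ring
  have hMoff : ∀ i j, i ≠ j → A i j = 0 → |M i j| ≤ B ^ 2 * |(F * M * F) i j| := by
    intro i j hij h0
    have hF0 : F i j = 0 := by simp [hF, saturatedPattern, h0]
    rw [hMe i j, Matrix.diagonal_apply_ne _ hij, hF0]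
    simpa using hvG i j
  have hMon : ∀ i j, i ≠ j → |M i j| ≤ B ^ 2 * lam + Q := by
    intro i j hij
    rw [hMe i j, Matrix.diagonal_apply_ne _ hij, zero_sub]
    refine (abs_add_le _ _).trans (add_le_add ?_ ((hvG i j).trans (hQ' i j)))
    rw [abs_neg, abs_mul, abs_mul, abs_of_pos (hv i), abs_of_pos (hv j)]
    calc v i * |F i j| * v j ≤ B * lam * B := by
          have := hv j
          have := hvB i
          have := hvB j
          have := hFl i j
          gcongr
      _ = B ^ 2 * lam := by ring
  set R := boxMultiplier γ A S M with hR
  have hRon : ∀ i j, i ≠ j → A i j ≠ 0 →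
      R i j = M i j - S i j + γ * (SignType.sign (A i j) : ℝ) := by
    intro i j hij h0
    simp [hR, boxMultiplier, hij, h0]
  have hRoff : ∀ i j, A i j = 0 → R i j = 0 := by
    intro i j h0
    simp [hR, boxMultiplier, h0]
  have hRd : ∀ i, R i i = 0 := fun i => by simp [hR, boxMultiplier]
  -- the estimate has the signs of `A`
  have hRneg : ∀ i j, i ≠ j → 0 < A i j → R i j < 0 := by
    intro i j hij hpos
    have h1 := hmin i j hij hpos.ne'
    rw [abs_of_pos hpos] at h1
    have h2 := abs_le.1 (hclose i j)
    have h3 := abs_le.1 (hMon i j hij)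
    rw [hRon i j hij hpos.ne', sign_pos hpos]
    simp only [SignType.coe_one, mul_one]
    linarith
  have hRpos : ∀ i j, i ≠ j → A i j < 0 → 0 < R i j := by
    intro i j hij hneg
    have h1 := hmin i j hij hneg.ne
    rw [abs_of_neg hneg] at h1
    have h2 := abs_le.1 (hclose i j)
    have h3 := abs_le.1 (hMon i j hij)
    rw [hRon i j hij hneg.ne, sign_neg hneg]
    simp only [SignType.coe_neg_one, mul_neg, mul_one]
    linarith
  have hkkt : IsKKTPair S γ lam J R := by
    refine ⟨hJ, ?_, hdiag, hRd, ?_, ?_, ?_, ?_⟩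
    · refine posDef_of_row_sum_sub_lt hAh
        (hMh.sub (boxMultiplier_isHermitian γ hAh hS hMh)) fun i => ?_
      have hentry : ∀ j, |(M - R - A) i j| ≤
          (if A i j ≠ 0 then δ + γ else 0) + B ^ 2 * |(F * M * F) i j| := by
        intro j
        have hnn : 0 ≤ B ^ 2 * |(F * M * F) i j| := by positivity
        have hc := abs_le.1 (hclose i j)
        rw [Matrix.sub_apply, Matrix.sub_apply]
        by_cases hij : i = j
        · subst hij
          rw [if_pos hA.diag_pos.ne', hRd, hdiag, sub_zero]
          have := hclose i i
          linarith
        · by_cases h0 : A i j = 0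
          · rw [hRoff i j h0, h0]
            simpa using hMoff i j hij h0
          · rw [if_pos h0, hRon i j hij h0]
            refine le_trans ?_ (le_add_of_nonneg_right hnn)
            rcases lt_or_gt_of_ne h0 with h | h
            · rw [sign_neg h, abs_le]
              simp only [SignType.coe_neg_one]
              constructor <;> linarith
            · rw [sign_pos h, abs_le]
              simp only [SignType.coe_one]
              constructor <;> linarith
      calc ∑ j, |(M - R - A) i j|
          ≤ ∑ j, ((if A i j ≠ 0 then δ + γ else 0) + B ^ 2 * |(F * M * F) i j|) :=
            Finset.sum_le_sum fun j _ => hentry j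
        _ = ∑ j, (if A i j ≠ 0 then δ + γ else 0) + B ^ 2 * ∑ j, |(F * M * F) i j| := by
            rw [Finset.sum_add_distrib, Finset.mul_sum]
        _ ≤ d * (δ + γ) + B ^ 2 * (2 * B * (lam * d) ^ 2) := by
            have := sum_row_support_le hAh (add_nonneg hδ hγ) i
            have := hGr i
            gcongr
        _ = d * (δ + γ) + 2 * B ^ 3 * (lam * d) ^ 2 := by ring
        _ < _ := heig
    · intro i j hij
      rw [hJoff i j hij]
      rcases lt_trichotomy (A i j) 0 with h | h | h <;> simp [h, abs_of_nonneg hlam0, hlam0]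
    · intro i j hij
      by_cases h0 : A i j = 0
      · rw [hRoff i j h0, sub_zero]
        have h1 := abs_le.1 ((hMoff i j hij h0).trans (hQ' i j))
        have h2 := hclose i j
        rw [h0, sub_zero] at h2
        have h2 := abs_le.1 h2
        have h3 := hoff i j hij
        rw [abs_le]
        constructor <;> linarith
      · rw [hRon i j hij h0]
        have e : M i j - S i j - (M i j - S i j + γ * (SignType.sign (A i j) : ℝ)) =
            -(γ * (SignType.sign (A i j) : ℝ)) := by ring
        rw [e, abs_neg]
        rcases lt_or_gt_of_ne h0 with h | h <;> simp [h, abs_of_nonneg hγ]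
    · intro i j hij
      rw [hJoff i j hij]
      rcases lt_trichotomy (A i j) 0 with h | h | h
      · rw [abs_of_pos (hRpos i j hij h), sign_neg h]
        simp only [SignType.coe_neg_one]
        ring
      · simp [hRoff i j h]
      · rw [abs_of_neg (hRneg i j hij h), sign_pos h]
        simp only [SignType.coe_one]
        ring
    · intro i j hij
      rw [hJoff i j hij]
      rcases lt_trichotomy (A i j) 0 with h | h | h
      · rw [hRon i j hij h.ne, sign_neg h]
        simp only [SignType.coe_neg_one, mul_neg, mul_one, neg_neg, abs_of_nonneg hlam0]
        ring
      · simp [h]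
      · rw [hRon i j hij h.ne', sign_pos h]
        simp only [SignType.coe_one, mul_one, abs_neg, abs_of_nonneg hlam0]
        ring
  have hest : ∀ i j, i ≠ j → covEstimate M R i j = -R i j := fun i j hij => by
    simp [covEstimate, hij]
  have hsign : ∀ i j, i ≠ j →
      SignType.sign (covEstimate M R i j) = SignType.sign (A i j) := by
    intro i j hij
    rw [hest i j hij]
    rcases lt_trichotomy (A i j) 0 with h | h | h
    · rw [sign_neg h, sign_neg (neg_neg_of_pos (hRpos i j hij h))]
    · rw [hRoff i j h, h, neg_zero]
    · rw [sign_pos h, sign_pos (neg_pos.2 (hRneg i j hij h))]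
  refine ⟨J, M, R, hkkt.primalOptimal hlam0, hkkt.dualOptimal hγ, rfl,
    fun M' R' h' => hkkt.dual_unique hγ hlam h', ?_, ?_, hsign⟩
  · rw [offLinf_le_iff _ herr0]
    intro i j hij
    rw [Matrix.sub_apply, hest i j hij]
    by_cases h0 : A i j = 0
    · rw [hRoff i j h0, h0]
      simpa using herr0
    · rw [hRon i j hij h0]
      have h2 := abs_le.1 (hclose i j)
      have h3 := abs_le.1 (hMon i j hij)
      have h4 := herr i j hij
      rcases lt_or_gt_of_ne h0 with h | h
      · rw [sign_neg h, abs_le]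
        simp only [SignType.coe_neg_one]
        constructor <;> linarith
      · rw [sign_pos h, abs_le]
        simp only [SignType.coe_one]
        constructor <;> linarith
  · ext ⟨i, j⟩
    simp only [offSupport, Set.mem_ofPred_eq]
    refine and_congr_right fun hij => not_congr ?_
    rw [← sign_eq_zero_iff, hsign i j hij, sign_eq_zero_iff]

end Deterministic

/-! ### Concentration of the entries of a Gaussian sample covariance matrix -/

section Concentration

open Real

theorem exp_le_one_add_add_sq_mul_exp_abs (u : ℝ) : exp u ≤ 1 + u + u ^ 2 * exp |u| := by
  have h1 : exp u - 1 ≤ u * exp u := by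
    have h2 := add_one_le_exp (-u)
    have h3 : exp (-u) * exp u = 1 := by rw [← exp_add]; simp
    nlinarith [exp_pos u]
  rcases le_total 0 u with hu | hu
  · rw [abs_of_nonneg hu]
    nlinarith
  · have h2 := add_one_le_exp u
    have h3 : u ^ 2 * 1 ≤ u ^ 2 * exp |u| :=
      mul_le_mul_of_nonneg_left (one_le_exp (abs_nonneg u)) (sq_nonneg u)
    nlinarith

variable {Ω : Type*} [MeasurableSpace Ω] {P : Measure Ω}

/-- A centred variable with `E exp (c |W|) ≤ 2` has a sub-Gaussian moment generating function near
the origin. -/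
theorem mgf_le_of_integral_exp_abs_le [IsProbabilityMeasure P] {W : Ω → ℝ} {c t : ℝ} (hc : 0 < c)
    (hW : AEMeasurable W P) (hint : Integrable (fun ω => exp (c * |W ω|)) P)
    (hle : ∫ ω, exp (c * |W ω|) ∂P ≤ 2) (hmean : ∫ ω, W ω ∂P = 0) (ht : |t| ≤ c / 2) :
    Integrable (fun ω => exp (t * W ω)) P ∧ mgf W P t ≤ exp (16 * t ^ 2 / c ^ 2) := by
  have habs : ∀ ω, |t * W ω| ≤ c / 2 * |W ω| := fun ω => by
    rw [abs_mul]; exact mul_le_mul_of_nonneg_right ht (abs_nonneg _)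
  have hWint : Integrable W P := by
    refine Integrable.mono' (hint.const_mul c⁻¹) hW.aestronglyMeasurable
      (Filter.Eventually.of_forall fun ω => ?_)
    rw [Real.norm_eq_abs, inv_mul_eq_div, le_div_iff₀ hc]
    linarith [add_one_le_exp (c * |W ω|)]
  have hpt : ∀ ω, exp (t * W ω) ≤ 1 + t * W ω + 8 * t ^ 2 / c ^ 2 * exp (c * |W ω|) := by
    intro ω
    refine (exp_le_one_add_add_sq_mul_exp_abs _).trans (add_le_add le_rfl ?_)
    have h1 : exp |t * W ω| ≤ exp (c / 2 * |W ω|) := exp_le_exp.2 (habs ω)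
    have h2 : W ω ^ 2 ≤ 8 / c ^ 2 * exp (c / 2 * |W ω|) := by
      have h3 := quadratic_le_exp_of_nonneg (x := c / 2 * |W ω|) (by positivity)
      have h4 : 0 ≤ c / 2 * |W ω| := by positivity
      rw [div_mul_eq_mul_div, le_div_iff₀ (by positivity)]
      have h5 : (c / 2 * |W ω|) ^ 2 = c ^ 2 * W ω ^ 2 / 4 := by rw [mul_pow, sq_abs]; ring
      linarith
    calc (t * W ω) ^ 2 * exp |t * W ω|
        ≤ (t ^ 2 * (8 / c ^ 2 * exp (c / 2 * |W ω|))) * exp (c / 2 * |W ω|) := by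
          rw [mul_pow]; gcongr
      _ = 8 * t ^ 2 / c ^ 2 * (exp (c / 2 * |W ω|) * exp (c / 2 * |W ω|)) := by ring
      _ = 8 * t ^ 2 / c ^ 2 * exp (c * |W ω|) := by
          rw [← exp_add]; congr 2; ring
  have hint2 : Integrable (fun ω => exp (t * W ω)) P := by
    refine Integrable.mono' hint ((hW.const_mul t).exp.aestronglyMeasurable)
      (Filter.Eventually.of_forall fun ω => ?_)
    rw [Real.norm_eq_abs, abs_of_pos (exp_pos _), exp_le_exp]
    have h1 := habs ω
    have h2 : 0 ≤ c * |W ω| := by positivity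
    linarith [le_abs_self (t * W ω)]
  refine ⟨hint2, ?_⟩
  have hint1 : Integrable (fun ω => 1 + t * W ω) P :=
    (integrable_const 1).add (hWint.const_mul t)
  calc mgf W P t ≤ ∫ ω, (1 + t * W ω + 8 * t ^ 2 / c ^ 2 * exp (c * |W ω|)) ∂P :=
        integral_mono hint2 (hint1.add (hint.const_mul _)) hpt
    _ = 1 + 8 * t ^ 2 / c ^ 2 * ∫ ω, exp (c * |W ω|) ∂P := by
        rw [integral_add hint1 (hint.const_mul _),
          integral_add (integrable_const 1) (hWint.const_mul t), integral_const_mul,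
          integral_const_mul, hmean]
        simp
    _ ≤ 1 + 8 * t ^ 2 / c ^ 2 * 2 := by gcongr
    _ = 16 * t ^ 2 / c ^ 2 + 1 := by ring
    _ ≤ exp (16 * t ^ 2 / c ^ 2) := add_one_le_exp _

/-- Bernstein's inequality, in the range of deviations where the tail is sub-Gaussian. -/
theorem measureReal_sum_ge_le [IsProbabilityMeasure P] {n : ℕ} {W : Fin n → Ω → ℝ} {c ε : ℝ}
    (hc : 0 < c) (hε : 0 ≤ ε) (hεc : ε ≤ 16 / c) (hind : iIndepFun W P)
    (hW : ∀ k, AEMeasurable (W k) P)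
    (hint : ∀ k, Integrable (fun ω => exp (c * |W k ω|)) P)
    (hle : ∀ k, ∫ ω, exp (c * |W k ω|) ∂P ≤ 2) (hmean : ∀ k, ∫ ω, W k ω ∂P = 0) :
    P.real {ω | n * ε ≤ ∑ k, W k ω} ≤ exp (-(n * (c * ε) ^ 2 / 64)) := by
  -- the Chernoff exponent `-t ε + 16 t² / c²` is minimal at `t = c² ε / 32`
  set t := c ^ 2 * ε / 32 with ht
  have ht0 : 0 ≤ t := by positivity
  have htc : |t| ≤ c / 2 := by
    rw [abs_of_nonneg ht0, ht]
    rw [le_div_iff₀ hc] at hεc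
    nlinarith
  have hm := fun k => mgf_le_of_integral_exp_abs_le hc (hW k) (hint k) (hle k) (hmean k) htc
  have hsum := hind.mgf_sum₀ (t := t) hW Finset.univ
  have hpos : 0 < mgf (∑ k, W k) P t := by
    rw [hsum]
    exact Finset.prod_pos fun k _ => mgf_pos (hm k).1
  have hi : Integrable (fun ω => exp (t * (∑ k, W k) ω)) P := by
    by_contra h
    exact hpos.ne' (mgf_undef h)
  have h1 := measure_ge_le_exp_mul_mgf (n * ε) ht0 hi
  have h2 : mgf (∑ k, W k) P t ≤ exp (n * (16 * t ^ 2 / c ^ 2)) := by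
    rw [hsum, exp_nat_mul]
    refine (Finset.prod_le_prod (fun k _ => mgf_nonneg) fun k _ => (hm k).2).trans ?_
    simp
  simp only [Finset.sum_apply] at h1
  calc _ ≤ exp (-t * (n * ε)) * mgf (∑ k, W k) P t := h1
    _ ≤ exp (-t * (n * ε)) * exp (n * (16 * t ^ 2 / c ^ 2)) := by gcongr
    _ = exp (-(n * (c * ε) ^ 2 / 64)) := by
        rw [← exp_add, ht]; congr 1; field_simp; ring

theorem measureReal_abs_sum_ge_le [IsProbabilityMeasure P] {n : ℕ} {W : Fin n → Ω → ℝ} {c ε : ℝ}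
    (hc : 0 < c) (hε : 0 ≤ ε) (hεc : ε ≤ 16 / c) (hind : iIndepFun W P)
    (hW : ∀ k, AEMeasurable (W k) P)
    (hint : ∀ k, Integrable (fun ω => exp (c * |W k ω|)) P)
    (hle : ∀ k, ∫ ω, exp (c * |W k ω|) ∂P ≤ 2) (hmean : ∀ k, ∫ ω, W k ω ∂P = 0) :
    P.real {ω | n * ε ≤ |∑ k, W k ω|} ≤ 2 * exp (-(n * (c * ε) ^ 2 / 64)) := by
  have h1 := measureReal_sum_ge_le hc hε hεc hind hW hint hle hmean
  have h2 := measureReal_sum_ge_le (W := fun k ω => -W k ω) hc hε hεc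
    (hind.comp (fun _ => Neg.neg) fun _ => measurable_neg) (fun k => (hW k).neg)
    (by simpa using hint) (by simpa using hle) (by simpa [integral_neg] using hmean)
  have h3 : {ω | n * ε ≤ |∑ k, W k ω|} ⊆
      {ω | n * ε ≤ ∑ k, W k ω} ∪ {ω | n * ε ≤ ∑ k, -W k ω} := by
    intro ω hω
    simp only [Set.mem_ofPred_eq, Set.mem_union, Finset.sum_neg_distrib] at hω ⊢
    exact le_abs.1 hω
  have h4 := (measureReal_mono h3 (μ := P)).trans (measureReal_union_le _ _)
  linarith

/-- The moment generating function of the square of a centred Gaussian, at a point where it is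
bounded. -/
theorem integral_exp_mul_sq_gaussianReal_le {v : NNReal} (hv : v ≠ 0) {c : ℝ}
    (hcv : c * v ≤ 1 / 4) :
    Integrable (fun x => exp (c * x ^ 2)) (gaussianReal 0 v) ∧
      ∫ x, exp (c * x ^ 2) ∂(gaussianReal 0 v) ≤ √2 := by
  have hv0 : (0 : ℝ) < v := by exact_mod_cast pos_iff_ne_zero.2 hv
  set b : ℝ := (2 * (v : ℝ))⁻¹ - c with hb
  have hbv : 1 / 4 ≤ b * v := by
    rw [hb, sub_mul, mul_inv, mul_assoc, inv_mul_cancel₀ hv0.ne']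
    linarith
  have hb0 : 0 < b := by
    by_contra! h
    nlinarith
  have hfun : ∀ x : ℝ, gaussianPDFReal 0 v x • exp (c * x ^ 2) =
      (√(2 * π * v))⁻¹ * exp (-b * x ^ 2) := by
    intro x
    rw [gaussianPDFReal_def, smul_eq_mul, mul_assoc, ← exp_add]
    congr 2
    rw [hb]
    field_simp
    ring
  constructor
  · rw [gaussianReal_of_var_ne_zero _ hv,
      integrable_withDensity_iff_integrable_smul' (measurable_gaussianPDF _ _)
        (ae_of_all _ fun _ => gaussianPDF_lt_top)]
    simp only [toReal_gaussianPDF, hfun]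
    exact (integrable_exp_neg_mul_sq hb0).const_mul _
  · rw [integral_gaussianReal_eq_integral_smul hv]
    simp only [hfun]
    rw [integral_const_mul, integral_gaussian, inv_mul_eq_div, ← Real.sqrt_div (by positivity)]
    refine Real.sqrt_le_sqrt ?_
    rw [div_div, div_le_iff₀ (by positivity)]
    nlinarith [pi_pos]

theorem exp_abs_mul_le (c x y : ℝ) (hc : 0 ≤ c) :
    exp (c * |x * y|) ≤ (exp (c * x ^ 2) + exp (c * y ^ 2)) / 2 := by
  have h1 : |x * y| ≤ (x ^ 2 + y ^ 2) / 2 := by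
    rw [abs_mul]
    nlinarith [sq_nonneg (|x| - |y|), sq_abs x, sq_abs y]
  have h2 : exp (c * |x * y|) ≤ exp (c * x ^ 2 / 2) * exp (c * y ^ 2 / 2) := by
    rw [← exp_add, exp_le_exp]
    nlinarith
  have h3 : ∀ z, exp (c * z ^ 2) = exp (c * z ^ 2 / 2) ^ 2 := fun z => by
    rw [← exp_nat_mul]
    congr 1
    push_cast
    ring
  rw [h3 x, h3 y]
  nlinarith [sq_nonneg (exp (c * x ^ 2 / 2) - exp (c * y ^ 2 / 2))]

variable {p : ℕ} {A : Matrix (Fin p) (Fin p) ℝ} {K : ℝ}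

theorem abs_apply_le_of_posSemidef (hA : A.PosSemidef) (hK : ∀ i, A i i ≤ K) (i j : Fin p) :
    |A i j| ≤ K := by
  have hs : A j i = A i j := by simpa using hA.1.apply i j
  have h1 := hA.dotProduct_mulVec_nonneg (Pi.single i 1 + Pi.single j 1)
  have h2 := hA.dotProduct_mulVec_nonneg (Pi.single i 1 - Pi.single j 1)
  simp [Matrix.mulVec_add, Matrix.mulVec_sub, add_dotProduct, sub_dotProduct, dotProduct_add,
    dotProduct_sub] at h1 h2
  have := hK i
  have := hK j
  rw [abs_le]
  constructor <;> linarith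

theorem integrable_exp_mul_sq_eval (hA : A.PosDef) (hK0 : 0 < K) (hK : ∀ i, A i i ≤ K)
    (i : Fin p) :
    Integrable (fun x : EuclideanSpace ℝ (Fin p) => exp (1 / (4 * K) * x i ^ 2))
        (multivariateGaussian 0 A) ∧
      ∫ x, exp (1 / (4 * K) * x i ^ 2) ∂(multivariateGaussian 0 A) ≤ √2 := by
  have hmp := measurePreserving_eval_multivariateGaussian (μ := 0) hA.posSemidef (i := i)
  have hpos : 0 < A i i := hA.diag_pos
  have hv : (A i i).toNNReal ≠ 0 := by simpa using hpos
  have hcv : 1 / (4 * K) * ((A i i).toNNReal : ℝ) ≤ 1 / 4 := by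
    rw [Real.coe_toNNReal _ hpos.le, div_mul_eq_mul_div, div_le_iff₀ (by positivity)]
    linarith [hK i]
  obtain ⟨h1, h2⟩ := integral_exp_mul_sq_gaussianReal_le hv hcv
  have e : (0 : EuclideanSpace ℝ (Fin p)) i = 0 := rfl
  rw [e] at hmp
  rw [← hmp.map_eq] at h1 h2
  rw [integral_map hmp.measurable.aemeasurable
    (by fun_prop)] at h2
  exact ⟨(integrable_map_measure (by fun_prop) hmp.measurable.aemeasurable).1 h1, h2⟩

/-- The exponential moment of a product of coordinates reduces to those of the squares, so no joint
law beyond the covariance enters. -/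
theorem centered_product_integrals (hA : A.PosDef) (hK0 : 0 < K) (hK : ∀ i, A i i ≤ K)
    (i j : Fin p) :
    Integrable (fun x : EuclideanSpace ℝ (Fin p) => exp (1 / (4 * K) * |x i * x j - A i j|))
        (multivariateGaussian 0 A) ∧
      ∫ x, exp (1 / (4 * K) * |x i * x j - A i j|) ∂(multivariateGaussian 0 A) ≤ 2 ∧
      ∫ x, (x i * x j - A i j) ∂(multivariateGaussian 0 A) = 0 := by
  obtain ⟨hi1, hi2⟩ := integrable_exp_mul_sq_eval hA hK0 hK i
  obtain ⟨hj1, hj2⟩ := integrable_exp_mul_sq_eval hA hK0 hK j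
  set c := 1 / (4 * K) with hc
  have hc0 : 0 < c := by positivity
  have hcK : c * K = 1 / 4 := by rw [hc]; field_simp
  have hpt : ∀ x : EuclideanSpace ℝ (Fin p), exp (c * |x i * x j - A i j|) ≤
      4 / 3 * ((exp (c * x i ^ 2) + exp (c * x j ^ 2)) / 2) := by
    intro x
    have h1 : c * |x i * x j - A i j| ≤ 1 / 4 + c * |x i * x j| := by
      have h2 := abs_sub (x i * x j) (A i j)
      have h3 := abs_apply_le_of_posSemidef hA.posSemidef hK i j
      nlinarith
    have h4 : exp (1 / 4 : ℝ) ≤ 4 / 3 := by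
      have h5 := add_one_le_exp (-(1 / 4) : ℝ)
      have h6 : exp (-(1 / 4) : ℝ) * exp (1 / 4) = 1 := by rw [← exp_add]; simp
      nlinarith [exp_pos (1 / 4 : ℝ)]
    calc exp (c * |x i * x j - A i j|) ≤ exp (1 / 4) * exp (c * |x i * x j|) := by
          rw [← exp_add]; exact exp_le_exp.2 h1
      _ ≤ _ := mul_le_mul h4 (exp_abs_mul_le c _ _ hc0.le) (exp_pos _).le (by norm_num)
  have hint : Integrable (fun x : EuclideanSpace ℝ (Fin p) =>
      4 / 3 * ((exp (c * x i ^ 2) + exp (c * x j ^ 2)) / 2)) (multivariateGaussian 0 A) :=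
    ((hi1.add hj1).div_const 2).const_mul _
  have hint1 : Integrable (fun x : EuclideanSpace ℝ (Fin p) => exp (c * |x i * x j - A i j|))
      (multivariateGaussian 0 A) := by
    refine hint.mono' (Measurable.aestronglyMeasurable (by fun_prop))
      (Filter.Eventually.of_forall fun x => ?_)
    rw [Real.norm_eq_abs, abs_of_pos (exp_pos _)]
    exact hpt x
  refine ⟨hint1, ?_, ?_⟩
  · refine (integral_mono hint1 hint hpt).trans ?_
    rw [integral_const_mul, integral_div, integral_add hi1 hj1]
    have : √2 ≤ 3 / 2 := by
      rw [Real.sqrt_le_left (by norm_num)]; norm_num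
    linarith
  · have hcov := covariance_eval_multivariateGaussian (μ := 0) hA.posSemidef i j
    have hmem : ∀ i, MemLp (fun x : EuclideanSpace ℝ (Fin p) => x i) 2
        (multivariateGaussian 0 A) := fun i =>
      IsGaussian.memLp_dual (multivariateGaussian 0 A) (EuclideanSpace.proj i) 2 (by simp)
    have hmean : ∀ i, ∫ x : EuclideanSpace ℝ (Fin p), x i ∂(multivariateGaussian 0 A) = 0 := by
      intro i
      have h := (EuclideanSpace.proj (𝕜 := ℝ) i).integral_comp_comm
        (IsGaussian.integrable_fun_id (μ := multivariateGaussian 0 A))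
      rw [integral_id_multivariateGaussian] at h
      simpa using h
    rw [covariance_eq_sub (hmem i) (hmem j), hmean, hmean] at hcov
    simp only [Pi.mul_apply, mul_zero, sub_zero] at hcov
    have hprod : Integrable (fun x : EuclideanSpace ℝ (Fin p) => x i * x j)
        (multivariateGaussian 0 A) := (hmem i).integrable_mul (hmem j)
    rw [integral_sub hprod (integrable_const _), hcov]
    simp

theorem sampleCov_apply_sub {n : ℕ} (hn : 1 ≤ n) (x : Fin n → EuclideanSpace ℝ (Fin p))
    (i j : Fin p) :
    n * (sampleCov x i j - A i j) = ∑ k, (x k i * x k j - A i j) := by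
  have : (n : ℝ) ≠ 0 := by positivity
  simp only [sampleCov, Matrix.smul_apply, Matrix.sum_apply, Matrix.vecMulVec_apply, smul_eq_mul,
    Finset.sum_sub_distrib, Finset.sum_const, Finset.card_univ, Fintype.card_fin, nsmul_eq_mul]
  field_simp

theorem measureReal_sampleCov_entry_le [IsProbabilityMeasure P] (hA : A.PosDef) (hK0 : 0 < K)
    (hK : ∀ i, A i i ≤ K) {n : ℕ} (hn : 1 ≤ n) {X : Fin n → Ω → EuclideanSpace ℝ (Fin p)}
    (hind : iIndepFun X P) (hlaw : ∀ k, HasLaw (X k) (multivariateGaussian 0 A) P)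
    {L : ℝ} (hL : 0 ≤ L) (hLn : L / n ≤ 4) (i j : Fin p) :
    P.real {ω | 32 * K * √(L / n) < |sampleCov (fun k => X k ω) i j - A i j|} ≤
      2 * exp (-L) := by
  have hn0 : (0 : ℝ) < n := by exact_mod_cast hn
  obtain ⟨h1, h2, h3⟩ := centered_product_integrals hA hK0 hK i j
  have hmeas : Measurable fun x : EuclideanSpace ℝ (Fin p) => x i * x j - A i j := by fun_prop
  have hs : √(L / n) ≤ 2 := by
    rw [Real.sqrt_le_left (by norm_num)]; linarith
  have key := measureReal_abs_sum_ge_le (P := P) (c := 1 / (4 * K)) (ε := 32 * K * √(L / n))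
    (W := fun k ω => X k ω i * X k ω j - A i j) (by positivity) (by positivity)
    (by
      have : 16 / (1 / (4 * K)) = 64 * K := by field_simp; norm_num
      rw [this]; nlinarith)
    (hind.comp (fun _ x => x i * x j - A i j) fun _ => hmeas)
    (fun k => hmeas.comp_aemeasurable (hlaw k).aemeasurable)
    (fun k => by
      rw [← (hlaw k).map_eq] at h1
      exact (integrable_map_measure (by fun_prop) (hlaw k).aemeasurable).1 h1)
    (fun k => ((hlaw k).integral_comp (f := fun x => exp (1 / (4 * K) * |x i * x j - A i j|))
      (by fun_prop)).trans_le h2)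
    (fun k => ((hlaw k).integral_comp (f := fun x => x i * x j - A i j) (by fun_prop)).trans h3)
  have e : (n : ℝ) * (1 / (4 * K) * (32 * K * √(L / n))) ^ 2 / 64 = L := by
    have : 1 / (4 * K) * (32 * K * √(L / n)) = 8 * √(L / n) := by
      field_simp
      ring
    rw [this, mul_pow, Real.sq_sqrt (by positivity)]
    field_simp
    ring
  rw [e] at key
  refine (measureReal_mono fun ω hω => ?_).trans key
  simp only [Set.mem_ofPred_eq] at hω ⊢
  rw [← sampleCov_apply_sub (A := A) hn (fun k => X k ω) i j, abs_mul, abs_of_pos hn0]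
  exact mul_le_mul_of_nonneg_left hω.le hn0.le

/-- Union bound over the `p ^ 2` entries: each fails with probability at most
`2 * exp (-L) = 1 / (2 * p ^ τ)`, where `L = log (4 * p ^ τ)`. The samples are only a.e. measurable,
so the event is the complement of a measurable hull of the bad set. -/
theorem exists_event_sampleCov_close [IsProbabilityMeasure P] (hA : A.PosDef) (hK0 : 0 < K)
    (hK : ∀ i, A i i ≤ K) {n : ℕ} (hp : 1 ≤ p) (hn : 1 ≤ n)
    {X : Fin n → Ω → EuclideanSpace ℝ (Fin p)}
    (hind : iIndepFun X P) (hlaw : ∀ k, HasLaw (X k) (multivariateGaussian 0 A) P)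
    {τ : ℝ} (hL : 0 ≤ log (4 * (p : ℝ) ^ τ)) (hLn : log (4 * (p : ℝ) ^ τ) / n ≤ 4) :
    ∃ G : Set Ω, MeasurableSet G ∧ 1 - 1 / (p : ℝ) ^ (τ - 2) < P.real G ∧
      ∀ ω ∈ G, ∀ i j, |sampleCov (fun k => X k ω) i j - A i j| ≤
        32 * K * √(log (4 * (p : ℝ) ^ τ) / n) := by
  have hp0 : (0 : ℝ) < p := by exact_mod_cast hp
  set L := log (4 * (p : ℝ) ^ τ) with hLdef
  set bad : Set Ω := ⋃ e : Fin p × Fin p,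
    {ω | 32 * K * √(L / n) < |sampleCov (fun k => X k ω) e.1 e.2 - A e.1 e.2|} with hbad
  have h1 : P.real bad ≤ ∑ _e : Fin p × Fin p, 2 * exp (-L) :=
    (measureReal_iUnion_fintype_le _).trans (Finset.sum_le_sum fun e _ =>
      measureReal_sampleCov_entry_le hA hK0 hK hn hind hlaw hL hLn e.1 e.2)
  have h2 : ∑ _e : Fin p × Fin p, 2 * exp (-L) = 1 / 2 * (1 / (p : ℝ) ^ (τ - 2)) := by
    rw [hLdef, exp_neg, exp_log (by positivity), rpow_sub hp0]
    simp only [Finset.sum_const, Finset.card_univ, Fintype.card_prod, Fintype.card_fin,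
      nsmul_eq_mul, Nat.cast_mul, rpow_two]
    field_simp
    norm_num
  have hq : 0 < 1 / (p : ℝ) ^ (τ - 2) := by positivity
  refine ⟨(toMeasurable P bad)ᶜ, (measurableSet_toMeasurable P bad).compl, ?_, ?_⟩
  · rw [probReal_compl_eq_one_sub (measurableSet_toMeasurable P bad), measureReal_def,
      measure_toMeasurable, ← measureReal_def]
    linarith
  · intro ω hω i j
    by_contra! h
    exact hω (subset_toMeasurable P bad (Set.mem_iUnion.2 ⟨(i, j), h⟩))

end Concentration

/-! ### Rates and constants -/

section Rates

variable {p n : ℕ} {A : Matrix (Fin p) (Fin p) ℝ}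

theorem minEigenvalue_le_diag (hA : A.IsHermitian) (i : Fin p) : minEigenvalue hA ≤ A i i := by
  have h := (posSemidef_sub_minEigenvalue hA).diag_nonneg (i := i)
  simpa using h

theorem one_le_maxDegree (hp : 1 ≤ p) (hA : A.PosDef) : 1 ≤ maxDegree A := by
  let i : Fin p := ⟨0, hp⟩
  refine le_trans ?_ (card_row_support_le_maxDegree hA.isHermitian i)
  exact Finset.card_pos.2 ⟨i, by simp [(hA.diag_pos (i := i)).ne']⟩

theorem rate_nonneg : 0 ≤ rate p n := Real.sqrt_nonneg _

theorem rate_pos (hp : 2 ≤ p) (hn : 1 ≤ n) : 0 < rate p n := by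
  have h1 : 0 < Real.log p := Real.log_pos (by exact_mod_cast hp)
  have h2 : (0 : ℝ) < n := by exact_mod_cast hn
  exact Real.sqrt_pos.2 (by positivity)

theorem log_four_mul_rpow {τ : ℝ} (hp : 1 ≤ p) :
    Real.log (4 * (p : ℝ) ^ τ) = 2 * Real.log 2 + τ * Real.log p := by
  have hp0 : (0 : ℝ) < p := by exact_mod_cast hp
  rw [Real.log_mul (by norm_num) (by positivity), Real.log_rpow hp0,
    show (4 : ℝ) = 2 ^ 2 by norm_num, Real.log_pow]
  norm_num

theorem log_four_mul_rpow_pos {τ : ℝ} (hp : 1 ≤ p) (hτ : 0 ≤ τ) :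
    0 < Real.log (4 * (p : ℝ) ^ τ) := by
  rw [log_four_mul_rpow hp]
  have h1 := Real.log_pos one_lt_two
  have h2 : 0 ≤ Real.log p := Real.log_nonneg (by exact_mod_cast hp)
  positivity

theorem rate_le_sqrt_log {τ : ℝ} (hp : 1 ≤ p) (hτ : 1 ≤ τ) :
    rate p n ≤ √(Real.log (4 * (p : ℝ) ^ τ) / n) := by
  refine Real.sqrt_le_sqrt (div_le_div_of_nonneg_right ?_ (Nat.cast_nonneg n))
  rw [log_four_mul_rpow hp]
  have h1 := Real.log_pos one_lt_two
  have h2 : 0 ≤ Real.log p := Real.log_nonneg (by exact_mod_cast hp)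
  nlinarith

theorem sqrt_log_le_rate {τ : ℝ} (hp : 2 ≤ p) (hτ : 0 ≤ τ) :
    √(Real.log (4 * (p : ℝ) ^ τ) / n) ≤ √(2 + τ) * rate p n := by
  rw [rate, ← Real.sqrt_mul (by positivity), ← mul_div_assoc]
  refine Real.sqrt_le_sqrt (div_le_div_of_nonneg_right ?_ (Nat.cast_nonneg n))
  rw [log_four_mul_rpow (by lia)]
  have h1 : Real.log 2 ≤ Real.log p := Real.log_le_log (by norm_num) (by exact_mod_cast hp)
  linarith

theorem maxDegree_mul_rate_le {ν : ℝ} (hn : 1 ≤ n)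
    (h : ν ^ 2 * (maxDegree A : ℝ) ^ 2 * Real.log p ≤ n) :
    ν * (maxDegree A * rate p n) ≤ 1 := by
  have hn0 : (0 : ℝ) < n := by exact_mod_cast hn
  have hlog : 0 ≤ Real.log p := Real.log_natCast_nonneg p
  refine (abs_le_of_sq_le_sq' ?_ zero_le_one).2
  rw [mul_pow, mul_pow, rate, Real.sq_sqrt (by positivity), one_pow, ← mul_assoc, ← mul_div_assoc,
    div_le_one hn0]
  exact h

end Rates

end SparseCov

theorem mainTheorem3 :
    ∀ K : ℝ, 0 < K → ∀ τ : ℝ, 2 < τ →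
    ∃ C₁₀ : ℝ, 0 < C₁₀ ∧ ∀ C₁ : ℝ, C₁₀ ≤ C₁ → ∀ C₂ : ℝ, 0 < C₂ →
    ∃ C₆ C₇ cMin cSample cErr : ℝ,
      0 < C₆ ∧ 0 < C₇ ∧ 0 < cMin ∧ 0 < cSample ∧ 0 < cErr ∧
      ∀ (p n : ℕ), 1 ≤ p → 1 ≤ n →
      ∀ (Sig : Matrix (Fin p) (Fin p) ℝ) (hSig : Sig.PosDef),
        (∀ i, Sig i i ≤ K) →
        SparseCov.EigenvalueControl C₆ C₇ τ n hSig.isHermitian →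
        (∀ i j, i ≠ j → Sig i j ≠ 0 → cMin * SparseCov.rate p n ≤ |Sig i j|) →
        cSample * (SparseCov.maxDegree Sig : ℝ) ^ 2 * Real.log p ≤ n →
        ∀ (Ω : Type*) [MeasurableSpace Ω] (P : Measure Ω) [IsProbabilityMeasure P]
          (X : Fin n → Ω → EuclideanSpace ℝ (Fin p)),
          iIndepFun X P →
          (∀ k, HasLaw (X k) (multivariateGaussian 0 Sig) P) →
          ∃ G : Set Ω, MeasurableSet G ∧
            1 - 1 / (p : ℝ) ^ (τ - 2) < P.real G ∧
            ∀ ω ∈ G,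
              SparseCov.Recovers (SparseCov.sampleCov fun k => X k ω)
                (C₁ * SparseCov.rate p n) (C₂ * SparseCov.rate p n)
                (cErr * SparseCov.rate p n) Sig := by
  intro K hK0 τ hτ
  have hκ : 2 ≤ √(2 + τ) := by
    rw [Real.le_sqrt (by norm_num) (by linarith)]; linarith
  have hC10 : 0 < 64 * K * √(2 + τ) := by positivity
  refine ⟨64 * K * √(2 + τ), hC10, fun C₁ hC₁ C₂ hC₂ => ?_⟩
  have hC10' : 0 < C₁ := hC10.trans_le hC₁
  -- the sample size condition with constant `ν ^ 2` gives `d * rate ≤ 1 / ν`; the two terms of `ν`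
  -- make `lam * d` small against `1 / K` and the second-order term small against `γ`
  set ν := 1 + 8 * C₂ * K + 4 * K ^ 2 * C₂ ^ 2 with hν
  have hν0 : 0 < ν := by positivity
  refine ⟨32 * K + C₁ + 1, 128 * K ^ 3 * C₂ ^ 2, 2 * C₁ + 16 * K ^ 2 * C₂ + 1, ν ^ 2,
    2 * C₁ + 16 * K ^ 2 * C₂, by positivity, by positivity, by positivity, by positivity,
    by positivity, ?_⟩
  intro p n hp hn Sig hSig hK heig hmin hsample Ω _ P _ X hind hlaw
  have hn0 : (0 : ℝ) < n := by exact_mod_cast hn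
  have hLpos := SparseCov.log_four_mul_rpow_pos (τ := τ) hp (by linarith)
  have hd1 : (1 : ℝ) ≤ SparseCov.maxDegree Sig := by
    exact_mod_cast SparseCov.one_le_maxDegree hp hSig
  have hdr := SparseCov.maxDegree_mul_rate_le hn hsample
  have hrL := SparseCov.rate_le_sqrt_log (n := n) (τ := τ) hp (by linarith)
  have hr0 := SparseCov.rate_nonneg (p := p) (n := n)
  have hLr : ∀ i j : Fin p, i ≠ j → √(Real.log (4 * (p : ℝ) ^ τ) / n) ≤
      √(2 + τ) * SparseCov.rate p n ∧ 0 < SparseCov.rate p n := by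
    intro i j hij
    have hp2 : 2 ≤ p := by
      have := Fin.val_ne_of_ne hij
      lia
    exact ⟨SparseCov.sqrt_log_le_rate hp2 (by linarith), SparseCov.rate_pos hp2 hn⟩
  have hmE : ∀ i, SparseCov.minEigenvalue hSig.isHermitian ≤ Sig i i :=
    SparseCov.minEigenvalue_le_diag hSig.isHermitian
  unfold SparseCov.EigenvalueControl at heig
  set L := Real.log (4 * (p : ℝ) ^ τ) with hL
  set d : ℝ := (SparseCov.maxDegree Sig : ℝ) with hd
  set r := SparseCov.rate p n with hr
  have hsq : √(L / n) ^ 2 = L / n := Real.sq_sqrt (by positivity)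
  rw [← hsq] at heig
  have hs0 : 0 < √(L / n) := Real.sqrt_pos.2 (by positivity)
  set s := √(L / n) with hs
  rw [Real.sqrt_sq hs0.le] at heig
  have hds : s ≤ d * s := le_mul_of_one_le_left hs0.le hd1
  have hq0 : 0 ≤ 128 * K ^ 3 * C₂ ^ 2 * d ^ 2 * s ^ 2 := by positivity
  -- the deviation `32 K s` is below the smallest eigenvalue, hence below every diagonal entry
  have hδ : 32 * K * s + C₁ * s + s ≤ SparseCov.minEigenvalue hSig.isHermitian := by
    have h1 : (32 * K + C₁ + 1) * s ≤ (32 * K + C₁ + 1) * (d * s) :=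
      mul_le_mul_of_nonneg_left hds (by positivity)
    nlinarith
  have hC1s : 0 < C₁ * s := by positivity
  have i₀ : Fin p := ⟨0, hp⟩
  -- keeps the deviation in the sub-Gaussian range of the tail bound
  have hs1 : s ≤ 1 := by
    have h1 := hmE i₀
    have h2 := hK i₀
    have h3 : 32 * K * s ≤ K := by linarith
    nlinarith
  obtain ⟨G, hGm, hGp, hG⟩ := SparseCov.exists_event_sampleCov_close hSig hK0 hK hp hn hind hlaw
    hLpos.le (by rw [← hL, ← hsq]; nlinarith)
  refine ⟨G, hGm, hGp, fun ω hω => ?_⟩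
  have hclose := hG ω hω
  rw [← hL, ← hs] at hclose
  have hKs : 0 < K * s := by positivity
  have hdr0 : 0 ≤ d * r := by positivity
  -- the second-order term of `J⁻¹` is at most half of `γ`
  have hquad : ∀ i j : Fin p, i ≠ j →
      32 * K * s + 2 * (4 * K) ^ 3 * (C₂ * r * d) * (C₂ * r) ≤ C₁ * r := by
    intro i j hij
    obtain ⟨h1, h2⟩ := hLr i j hij
    have h3 : 4 * K ^ 2 * C₂ ^ 2 * (d * r) ≤ 1 := by
      refine le_trans (mul_le_mul_of_nonneg_right ?_ hdr0) hdr
      rw [hν]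
      have : 0 < 8 * C₂ * K := by positivity
      linarith
    have h4 : 2 * (4 * K) ^ 3 * (C₂ * r * d) * (C₂ * r) =
        32 * K * (4 * K ^ 2 * C₂ ^ 2 * (d * r)) * r := by ring
    have h5 : 32 * K * (4 * K ^ 2 * C₂ ^ 2 * (d * r)) * r ≤ 32 * K * 1 * r := by gcongr
    have h6 : 32 * K * s ≤ 32 * K * (√(2 + τ) * r) := by gcongr
    have h7 : 64 * K * √(2 + τ) * r ≤ C₁ * r := by gcongr
    have h8 : 32 * K * 1 * r ≤ 32 * K * √(2 + τ) * r := by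
      gcongr
      linarith
    linarith
  refine SparseCov.recovers_of_entrywise_close (δ := 32 * K * s) (B := 4 * K) hSig ?_
    (by positivity) (by positivity) (fun i j hij => mul_pos hC₂ (hLr i j hij).2) (by positivity)
    (by positivity) hclose ?_ ?_ ?_ hquad ?_ ?_ (by positivity) ?_
  · refine Matrix.IsHermitian.ext fun i j => ?_
    simp [SparseCov.sampleCov, Matrix.sum_apply, Matrix.vecMulVec_apply, mul_comm]
  · intro i
    have h1 := abs_le.1 (hclose i i)
    have h2 := hmE i
    linarith
  · intro i
    have h1 := abs_le.1 (hclose i i)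
    have h2 := hmE i
    have h3 := hK i
    linarith
  · have h1 : 8 * C₂ * K * (d * r) ≤ 1 := by
      refine le_trans (mul_le_mul_of_nonneg_right ?_ hdr0) hdr
      rw [hν]
      have : 0 < 4 * K ^ 2 * C₂ ^ 2 := by positivity
      linarith
    linarith
  · intro i j hij h0
    have h1 := hmin i j hij h0
    have h2 := hquad i j hij
    have h3 := (hLr i j hij).2
    linarith
  · have h1 : d * (C₁ * r) ≤ d * (C₁ * s) := by gcongr
    have h2 : 2 * (4 * K) ^ 3 * (C₂ * r * d) ^ 2 ≤ 128 * K ^ 3 * C₂ ^ 2 * d ^ 2 * s ^ 2 := by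
      calc 2 * (4 * K) ^ 3 * (C₂ * r * d) ^ 2 = 128 * K ^ 3 * C₂ ^ 2 * d ^ 2 * r ^ 2 := by ring
        _ ≤ _ := by gcongr
    have h3 : 0 < d * s := by positivity
    rw [← hd]
    linarith
  · intro i j hij
    have h2 := hquad i j hij
    linarith
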